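/- Let $1\le k\le n-1$ and let $\Delta_{k,n}=\{x\in[0,1]^n : x_1+\cdots+x_n=k\}$ be the hypersimplex; for $J\subseteq\{1,\dots,n\}$ put $e_J=\sum_{j\in J}e_j$. A *subdivision* of a polytope $P$, given by its maximal cells, is a finite set of polytopes of the same dimension as $P$, with union $P$, any two of which meet in a common (possibly empty) face. It is *coarsest* if the only subdivisions of $P$ that it refines are itself and the trivial one $\{P\}$. For $d\ge 1$, a *$d$-split* of $P$ is a coarsest subdivision $P=P_1\cup\cdots\cup P_d$ with $d$ maximal cells such that any two distinct cells $P_i,P_j$ intersect in a common facet, $P_1\cap\cdots\cap P_d$ is nonempty, and $\operatorname{codim}(P_1\cap\cdots\cap P_d)=d-1$ in $P$; a *multi-split* is a $d$-split for some $d\ge 1$. A subdivision of $\Delta_{k,n}$ is a *matroid subdivision* if each of its maximal cells is a matroid polytope, i.e. the convex hull of the vectors $e_B$, where $B$ runs over the bases of some matroid on $\{1,\dots,n\}$. For an ordering $\sigma=(\sigma_1,\dots,\sigma_n)$ of $\{1,\dots,n\}$ let $$[\sigma_1,\dots,\sigma_n]=\Big\{x\in\mathbb{R}^n : \sum_{i=1}^n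 x_i=0,\ x_{\sigma_1}+\cdots+x_{\sigma_m}\ge 0\ \text{ for } 1\le m\le n-1\Big\}.$$ The *blade* $((\sigma_1,\dots,\sigma_n))=\bigcup_{j=1}^n\partial[\sigma_j,\sigma_{j+1},\dots,\sigma_{j-1}]$ (indices cyclic) is the union of the boundaries, relative to the hyperplane $\sum_i x_i=0$, of the $n$ cyclic rotations of this cone; it depends only on the cyclic order. Let $((\sigma_1,\dots,\sigma_n))_{e_J}$ be its translate by $e_J$. A subset $\mathcal{B}\subseteq P$ *induces* the subdivision of $P$ whose maximal cells are exactly the closures of the connected components of $P\setminus\mathcal{B}$. **Corollary.** For every multi-split matroid subdivision $\mathcal{S}$ of $\Delta_{k,n}$ there exist a vertex $e_J$ of $\Delta_{k,n}$ (that is, a $k$-element set $J\subseteq\{1,\dots,n\}$) and a cyclic order $(\sigma_1,\dots,\sigma_n)$ on $\{1,\dots,n\}$ such that $$((\sigma_1,\dots,\sigma_n))_{e_J}\cap\Delta_{k,n}$$ induces $\mathcal{S}$. -/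

import Mathlib

open scoped BigOperators

noncomputable section

/-- The vector `e_J = ∑_{j ∈ J} e_j`. -/
def indicatorVec {n : ℕ} (J : Set (Fin n)) : Fin n → ℝ :=
  J.indicator (fun _ => (1 : ℝ))

/-- The hypersimplex `Δ_{k,n}`, the set of all `x ∈ [0,1]^n` with `x_1 + ⋯ + x_n = k`. -/
def hypersimplex (k n : ℕ) : Set (Fin n → ℝ) :=
  {x | (∀ i, 0 ≤ x i ∧ x i ≤ 1) ∧ ∑ i, x i = (k : ℝ)}

/-! ### Plates and blades -/

/-- The plate `[(S_1)_{s_1}, …, (S_ℓ)_{s_ℓ}]`: the polyhedral cone in the hyperplane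
`x_1 + ⋯ + x_n = s_1 + ⋯ + s_ℓ` cut out by
`x_{S_1 ∪ ⋯ ∪ S_m} ≥ s_1 + ⋯ + s_m` for `1 ≤ m ≤ ℓ - 1`. -/
def plate {n ℓ : ℕ} (S : Fin ℓ → Finset (Fin n)) (s : Fin ℓ → ℤ) : Set (Fin n → ℝ) :=
  {x | ∑ i, x i = ((∑ a, s a : ℤ) : ℝ) ∧
    ∀ m : Fin ℓ, (m : ℕ) + 1 < ℓ →
      ((∑ a ∈ Finset.Iic m, s a : ℤ) : ℝ) ≤ ∑ a ∈ Finset.Iic m, ∑ i ∈ S a, x i}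

/-- The blade `(((S_1)_{s_1}, …, (S_ℓ)_{s_ℓ}))`: the union of the boundaries (relative to the
hyperplane in which they are full-dimensional) of the `ℓ` cyclic block rotations
`[(S_j)_{s_j}, (S_{j+1})_{s_{j+1}}, …, (S_{j-1})_{s_{j-1}}]` of the plate. -/
def blade {n ℓ : ℕ} (S : Fin ℓ → Finset (Fin n)) (s : Fin ℓ → ℤ) : Set (Fin n → ℝ) :=
  ⋃ j : Fin ℓ, intrinsicFrontier ℝ
    (plate (fun a => S ((finRotate ℓ ^ (j : ℕ)) a)) (fun a => s ((finRotate ℓ ^ (j : ℕ)) a)))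

/-- The blade `((σ_1, …, σ_n))` of a cyclic order: all blocks are singletons, all `s_i = 0`. -/
def cyclicBlade {n : ℕ} (σ : Equiv.Perm (Fin n)) : Set (Fin n → ℝ) :=
  blade (fun a => {σ a}) (fun _ => 0)

/-- The translation `((σ_1, …, σ_n))_p` of the blade of a cyclic order by the vector `p`. -/
def translatedBlade {n : ℕ} (σ : Equiv.Perm (Fin n)) (p : Fin n → ℝ) : Set (Fin n → ℝ) :=
  (fun x => p + x) '' cyclicBlade σ

/-! ### Polytopal subdivisions, given by their maximal cells -/

/-- A (convex) polytope: the convex hull of finitely many points. -/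
def IsPolytope {n : ℕ} (P : Set (Fin n → ℝ)) : Prop :=
  ∃ V : Set (Fin n → ℝ), V.Finite ∧ P = convexHull ℝ V

/-- The dimension of a nonempty convex set. -/
def affDim {n : ℕ} (P : Set (Fin n → ℝ)) : ℕ :=
  Module.finrank ℝ (vectorSpan ℝ P)

/-- `S` is the set of maximal cells of a polytopal subdivision of `P`: finitely many polytopes of
the same dimension as `P`, with union `P`, any two of which meet in a (possibly empty) common
face. -/
structure IsSubdivision {n : ℕ} (P : Set (Fin n → ℝ)) (S : Set (Set (Fin n → ℝ))) : Prop where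
  finite : S.Finite
  nonempty : ∀ Q ∈ S, Q.Nonempty
  polytope : ∀ Q ∈ S, IsPolytope Q
  dim_eq : ∀ Q ∈ S, affDim Q = affDim P
  cover : ⋃₀ S = P
  face : ∀ Q ∈ S, ∀ R ∈ S, IsExposed ℝ Q (Q ∩ R) ∧ IsExposed ℝ R (Q ∩ R)

/-- A subdivision is coarsest if the only subdivisions it refines are itself and the trivial
subdivision, whose only maximal cell is `P`. -/
def IsCoarsest {n : ℕ} (P : Set (Fin n → ℝ)) (S : Set (Set (Fin n → ℝ))) : Prop :=
  ∀ T : Set (Set (Fin n → ℝ)), IsSubdivision P T → (∀ Q ∈ S, ∃ R ∈ T, Q ⊆ R) → T = S ∨ T = {P}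

/-- `F` is a facet of the polytope `Q`. -/
def IsFacet {n : ℕ} (Q F : Set (Fin n → ℝ)) : Prop :=
  F.Nonempty ∧ IsExposed ℝ Q F ∧ affDim F + 1 = affDim Q

/-- `S` is the set of maximal cells of a `d`-split of `P`: a coarsest subdivision with `d ≥ 1`
maximal cells, distinct ones meeting in common facets, such that the intersection of all of them
has codimension `d - 1`. -/
structure IsSplit {n : ℕ} (d : ℕ) (P : Set (Fin n → ℝ)) (S : Set (Set (Fin n → ℝ))) : Prop where
  one_le : 1 ≤ d
  subdivision : IsSubdivision P S
  coarsest : IsCoarsest P S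
  card : S.ncard = d
  facet : ∀ Q ∈ S, ∀ R ∈ S, Q ≠ R → IsFacet Q (Q ∩ R) ∧ IsFacet R (Q ∩ R)
  common : (⋂₀ S).Nonempty
  codim : affDim (⋂₀ S) + (d - 1) = affDim P

/-- A multi-split is a `d`-split for some `d ≥ 1`. -/
def IsMultiSplit {n : ℕ} (P : Set (Fin n → ℝ)) (S : Set (Set (Fin n → ℝ))) : Prop :=
  ∃ d : ℕ, IsSplit d P S

/-- A matroid polytope: the convex hull of the vectors `e_B`, for the bases `B` of a matroid on
the ground set `{1, …, n}`. -/
def IsMatroidPolytope {n : ℕ} (Q : Set (Fin n → ℝ)) : Prop :=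
  ∃ M : Matroid (Fin n), M.E = Set.univ ∧
    Q = convexHull ℝ {x | ∃ B : Set (Fin n), M.IsBase B ∧ x = indicatorVec B}

/-- A matroid subdivision: every maximal cell is a matroid polytope. -/
def IsMatroidSubdivision {n : ℕ} (P : Set (Fin n → ℝ)) (S : Set (Set (Fin n → ℝ))) : Prop :=
  IsSubdivision P S ∧ ∀ Q ∈ S, IsMatroidPolytope Q

/-- The set `B` induces the subdivision of `P` with set of maximal cells `S`: the members of `S`
are exactly the chambers into which `B` cuts `P`, that is, the closures of the connected
components of `P \ B`. -/
def Induces {n : ℕ} (B P : Set (Fin n → ℝ)) (S : Set (Set (Fin n → ℝ))) : Prop :=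
  S = {Q | ∃ x ∈ P \ B, Q = closure (connectedComponentIn (P \ B) x)}

end

open scoped Matrix

/-! ### Matroids: symmetric exchange and local optimality -/

/-! All maximal cells share a vertex `e_J`: their intersection is an extreme subset of each cell, so
any extreme point of it is a vertex of every cell, and vertices of matroid polytopes are indicator
vectors. Near `e_J` a matroid polytope is governed by single exchanges: a basis that no exchange
improves has maximal weight (`Matroid.IsBase.dotProduct_le_of_exchange`). Hence a facet through
`e_J` is cut out by an equation `x_A = |A ∩ J|` (`IsCellAt.exists_facet_normal`), and two cells with
a common facet lie on opposite sides of such a hyperplane.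

For three cells, the sets `A`, `B`, `C` separating them cyclically satisfy `1_A + 1_B + 1_C = 1` or
`2` (`SeparatesAt.sum_eq`). Fix a cell `Q₀` and let `N R` be the set separating `Q₀` from `R`, with
`N Q₀ = ∅`. The three-cell relation makes the sets `N R` a chain, and each cell `Q` becomes the
region where `x_{N Q} - |N Q ∩ J|` is smallest among these functionals.

On the blade side, a point lies off the blade of `σ` translated to `e_J` exactly when the prefix
sums of `y = x - e_J` along `σ` have a unique minimum over one period (`mem_cyclicBlade_iff`).
Choose `σ` so that each `N Q` is an initial segment and, inside each block between consecutive
members of the chain, elements outside `J` precede those of `J`. On the hypersimplex `y` is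
nonnegative outside `J` and nonpositive on `J`, so the prefix sums rise and then fall in each block;
their minimum is attained at a member of the chain. The chambers of the blade are therefore the
interiors of the cells. -/

theorem Matroid.IsBase.exists_symm_exchange {α : Type*} {M : Matroid α} {B J : Set α} {a : α}
    (hB : M.IsBase B) (hJ : M.IsBase J) (haB : a ∈ B) (haJ : a ∉ J) :
    ∃ b ∈ J, b ∉ B ∧ M.IsBase (insert a (J \ {b})) ∧ M.IsBase (insert b (B \ {a})) := by
  have haE : a ∈ M.E := hB.subset_ground haB
  have hacl : a ∈ M.closure J := by rw [hJ.closure_eq]; exact haE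
  have hC := hJ.indep.fundCircuit_isCircuit hacl haJ
  -- The fundamental circuit of `a` in `J` puts `a` in the closure of its other elements. If these
  -- all lay in the closure of `B \ {a}`, so would `a`, against the independence of `B`.
  have hnot : ¬ M.fundCircuit a J \ {a} ⊆ M.closure (B \ {a}) := fun hsub => by
    have h1 : a ∈ M.closure (M.fundCircuit a J \ {a}) :=
      hC.mem_closure_sdiff_singleton_of_mem (M.mem_fundCircuit a J)
    exact hB.indep.notMem_closure_sdiff_of_mem haB
      (M.closure_subset_closure_of_subset_closure hsub h1)
  obtain ⟨b, ⟨hbC, hba⟩, hbcl⟩ := Set.not_subset.1 hnot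
  have hbJ : b ∈ J := (M.fundCircuit_subset_insert a J hbC).resolve_left hba
  refine ⟨b, hbJ, fun hbB => hbcl (M.mem_closure_of_mem' ⟨hbB, hba⟩ (hB.subset_ground hbB)), ?_,
    hB.exchange_base_of_notMem_closure haB hbcl (hJ.subset_ground hbJ)⟩
  have hba' : a ≠ b := fun h => haJ (h ▸ hbJ)
  have hset : insert a (J \ {b}) = insert a J \ {b} :=
    (Set.insert_sdiff_of_notMem J (by simpa using hba')).symm
  rw [hset]
  refine hJ.exchange_isBase_of_indep' hbJ haJ ?_
  exact (hJ.indep.mem_fundCircuit_iff hacl haJ).1 hbC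

theorem indicatorVec_apply {n : ℕ} (A : Set (Fin n)) (i : Fin n) [Decidable (i ∈ A)] :
    indicatorVec A i = if i ∈ A then 1 else 0 := by
  simp [indicatorVec, Set.indicator_apply]

theorem indicatorVec_compl {n : ℕ} (A : Set (Fin n)) : indicatorVec Aᶜ = 1 - indicatorVec A := by
  classical
  ext i
  by_cases h : i ∈ A <;> simp [indicatorVec_apply, h]

theorem indicatorVec_exchange {n : ℕ} {J : Set (Fin n)} {a b : Fin n} (ha : a ∉ J) (hb : b ∈ J) :
    indicatorVec (insert a (J \ {b})) = indicatorVec J + (Pi.single a 1 - Pi.single b 1) := by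
  classical
  ext i
  have hab : a ≠ b := fun h => ha (h ▸ hb)
  by_cases hia : i = a
  · subst hia; simp [indicatorVec_apply, ha, hab]
  · by_cases hib : i = b
    · subst hib; simp [indicatorVec_apply, hb, hia]
    · simp [indicatorVec_apply, hia, hib]

theorem dotProduct_exchange {n : ℕ} (w : Fin n → ℝ) {J : Set (Fin n)} {a b : Fin n}
    (ha : a ∉ J) (hb : b ∈ J) :
    w ⬝ᵥ indicatorVec (insert a (J \ {b})) = w ⬝ᵥ indicatorVec J + (w a - w b) := by
  rw [indicatorVec_exchange ha hb, dotProduct_add, dotProduct_sub]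
  simp

/-- A basis that no single exchange improves is a basis of maximal weight. -/
theorem Matroid.IsBase.dotProduct_le_of_exchange {n : ℕ} {M : Matroid (Fin n)} {J : Set (Fin n)}
    (hJ : M.IsBase J) (w : Fin n → ℝ)
    (hw : ∀ a ∉ J, ∀ b ∈ J, M.IsBase (insert a (J \ {b})) → w a ≤ w b) :
    ∀ B, M.IsBase B → w ⬝ᵥ indicatorVec B ≤ w ⬝ᵥ indicatorVec J := by
  suffices h : ∀ m, ∀ B, M.IsBase B → (B \ J).ncard = m →
      w ⬝ᵥ indicatorVec B ≤ w ⬝ᵥ indicatorVec J from fun B hB => h _ B hB rfl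
  intro m
  induction m with
  | zero =>
    intro B hB h0
    have : B ⊆ J := Set.sdiff_eq_empty.1 ((Set.ncard_eq_zero (Set.toFinite _)).1 h0)
    rw [hB.eq_of_subset_isBase hJ this]
  | succ m ih =>
    intro B hB hm
    obtain ⟨a, haB, haJ⟩ : (B \ J).Nonempty := by
      rw [← Set.ncard_pos (Set.toFinite _)]; lia
    -- Since `w a ≤ w b`, trading `a` for `b` in `B` does not lower the weight, and it brings `B`
    -- one element closer to `J`.
    obtain ⟨b, hbJ, hbB, h1, h2⟩ := hB.exists_symm_exchange hJ haB haJ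
    have hset : insert b (B \ {a}) \ J = (B \ J) \ {a} := by
      ext i; simp only [Set.mem_sdiff, Set.mem_insert_iff, Set.mem_singleton_iff]
      constructor
      · rintro ⟨rfl | h, hJ'⟩
        · exact absurd hbJ hJ'
        · exact ⟨⟨h.1, hJ'⟩, h.2⟩
      · rintro ⟨⟨h, h'⟩, h''⟩; exact ⟨Or.inr ⟨h, h''⟩, h'⟩
    have hcard : (insert b (B \ {a}) \ J).ncard = m := by
      rw [hset, Set.ncard_sdiff_singleton_of_mem (show a ∈ B \ J from ⟨haB, haJ⟩), hm]; rfl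
    have := ih _ h2 hcard
    rw [dotProduct_exchange w hbB haB] at this
    linarith [hw a haJ b hbJ h1]

/-- `Q` satisfies the local optimality criterion at `e_J`: a linear functional that does not
increase along the exchange directions from `e_J` into `Q` is maximal at `e_J`. -/
def LocallyGenerated {n : ℕ} (Q : Set (Fin n → ℝ)) (J : Set (Fin n)) : Prop :=
  ∀ w : Fin n → ℝ,
    (∀ a ∉ J, ∀ b ∈ J, indicatorVec (insert a (J \ {b})) ∈ Q → w a ≤ w b) →
    ∀ x ∈ Q, w ⬝ᵥ x ≤ w ⬝ᵥ indicatorVec J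

theorem Matroid.IsBase.locallyGenerated {n : ℕ} {M : Matroid (Fin n)} {J : Set (Fin n)}
    (hJ : M.IsBase J) :
    LocallyGenerated (convexHull ℝ {x | ∃ B : Set (Fin n), M.IsBase B ∧ x = indicatorVec B}) J := by
  intro w hw x hx
  have key := hJ.dotProduct_le_of_exchange w fun a ha b hb hB =>
    hw a ha b hb (subset_convexHull ℝ _ (by exact ⟨_, hB, rfl⟩))
  have hconv : Convex ℝ {y : Fin n → ℝ | w ⬝ᵥ y ≤ w ⬝ᵥ indicatorVec J} :=
    convex_halfSpace_le
      (f := fun y => w ⬝ᵥ y) (IsLinearMap.mk (dotProduct_add w) fun c y => dotProduct_smul c w y) _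
  refine convexHull_min ?_ hconv hx
  rintro _ ⟨B, hB, rfl⟩
  exact key B hB

/-! ### Functionals that are constant on a set -/

/-- The functionals, written as vectors, that vanish on `W`. -/
def annihilatorVec {n : ℕ} (W : Submodule ℝ (Fin n → ℝ)) : Submodule ℝ (Fin n → ℝ) :=
  W.dualAnnihilator.map (dotProductEquiv ℝ (Fin n)).symm.toLinearMap

theorem mem_annihilatorVec {n : ℕ} {W : Submodule ℝ (Fin n → ℝ)} {u : Fin n → ℝ} :
    u ∈ annihilatorVec W ↔ ∀ x ∈ W, u ⬝ᵥ x = 0 := by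
  rw [annihilatorVec, Submodule.mem_map_equiv]
  simp [Submodule.mem_dualAnnihilator]

theorem finrank_add_finrank_annihilatorVec {n : ℕ} (W : Submodule ℝ (Fin n → ℝ)) :
    Module.finrank ℝ W + Module.finrank ℝ (annihilatorVec W) = n := by
  rw [annihilatorVec, LinearEquiv.finrank_map_eq,
    Subspace.finrank_add_finrank_dualAnnihilator_eq, Module.finrank_fin_fun]

/-- The annihilator of `W` has dimension at most `m`, so `m` independent elements of it span it. -/
theorem mem_span_of_annihilates {n m : ℕ} (W : Submodule ℝ (Fin n → ℝ))
    (v : Fin m → Fin n → ℝ) (hv : LinearIndependent ℝ v) (hdim : n ≤ Module.finrank ℝ W + m)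
    (hvW : ∀ i, ∀ x ∈ W, v i ⬝ᵥ x = 0) (u : Fin n → ℝ) (hu : ∀ x ∈ W, u ⬝ᵥ x = 0) :
    u ∈ Submodule.span ℝ (Set.range v) := by
  have hsum := finrank_add_finrank_annihilatorVec W
  have hle : Submodule.span ℝ (Set.range v) ≤ annihilatorVec W :=
    Submodule.span_le.2 (by rintro _ ⟨i, rfl⟩; exact mem_annihilatorVec.2 (hvW i))
  have hspan := finrank_span_eq_card hv
  rw [Fintype.card_fin] at hspan
  rw [Submodule.eq_of_le_of_finrank_le hle (by lia)]
  exact mem_annihilatorVec.2 hu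

theorem dotProduct_vectorSpan_eq_zero {n : ℕ} {P : Set (Fin n → ℝ)} {u : Fin n → ℝ} {t : ℝ}
    (hu : ∀ x ∈ P, u ⬝ᵥ x = t) : ∀ x ∈ vectorSpan ℝ P, u ⬝ᵥ x = 0 := by
  intro x hx
  have : vectorSpan ℝ P ≤ LinearMap.ker (dotProductEquiv ℝ (Fin n) u) := by
    rw [vectorSpan_def, Submodule.span_le]
    rintro _ ⟨a, ha, b, hb, rfl⟩
    simp [dotProduct_sub, hu a ha, hu b hb]
  simpa using this hx

theorem eq_of_const_on_fullDim {n : ℕ} {Q : Set (Fin n → ℝ)} {k : ℝ} (hn : 0 < n)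
    (hdim : n ≤ affDim Q + 1) (hsum : ∀ x ∈ Q, 1 ⬝ᵥ x = k) {u : Fin n → ℝ} {t : ℝ}
    (hu : ∀ x ∈ Q, u ⬝ᵥ x = t) (i j : Fin n) : u i = u j := by
  have hv : LinearIndependent ℝ (fun _ : Fin 1 => (1 : Fin n → ℝ)) := by
    refine LinearIndependent.of_subsingleton (ι := Fin 1) 0 fun h => ?_
    simpa using congrFun h ⟨0, hn⟩
  have := mem_span_of_annihilates (vectorSpan ℝ Q) _ hv hdim
    (fun _ => dotProduct_vectorSpan_eq_zero hsum) u (dotProduct_vectorSpan_eq_zero hu)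
  rw [Set.range_const, Submodule.mem_span_singleton] at this
  obtain ⟨a, rfl⟩ := this
  simp

theorem exists_of_const_on_facet {n : ℕ} {F : Set (Fin n → ℝ)} {k r : ℝ}
    (hdim : n ≤ affDim F + 2) (hsum : ∀ x ∈ F, 1 ⬝ᵥ x = k)
    {A : Set (Fin n)} (hA : A.Nonempty) (hA' : Aᶜ.Nonempty)
    (hAF : ∀ x ∈ F, indicatorVec A ⬝ᵥ x = r) {u : Fin n → ℝ}
    (hu : ∀ x ∈ vectorSpan ℝ F, u ⬝ᵥ x = 0) : ∃ p q : ℝ, u = p • 1 + q • indicatorVec A := by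
  classical
  obtain ⟨i, hi⟩ := hA
  obtain ⟨j, hj⟩ := hA'
  have hj' : j ∉ A := hj
  have hv : LinearIndependent ℝ ![(1 : Fin n → ℝ), indicatorVec A] := by
    rw [LinearIndependent.pair_iff]
    intro s t h
    have h1 := congrFun h i
    have h2 := congrFun h j
    simp [indicatorVec_apply, hi, hj'] at h1 h2
    constructor <;> linarith
  have := mem_span_of_annihilates (vectorSpan ℝ F) _ hv hdim
    (fun l => by
      fin_cases l
      · exact dotProduct_vectorSpan_eq_zero hsum
      · exact dotProduct_vectorSpan_eq_zero hAF) u hu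
  rw [Matrix.range_cons, Matrix.range_cons, Matrix.range_empty, Set.union_empty,
    Set.singleton_union, Submodule.mem_span_pair] at this
  obtain ⟨p, q, h⟩ := this
  exact ⟨p, q, h.symm⟩

/-! ### Vertices and dimension of the hypersimplex -/

theorem one_dotProduct_indicatorVec {n : ℕ} (J : Finset (Fin n)) :
    1 ⬝ᵥ indicatorVec (J : Set (Fin n)) = J.card := by
  classical
  simp [dotProduct, indicatorVec_apply]

theorem indicatorVec_mem_hypersimplex {n : ℕ} (J : Finset (Fin n)) :
    indicatorVec (J : Set (Fin n)) ∈ hypersimplex J.card n := by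
  classical
  refine ⟨fun i => ?_, by simpa [dotProduct] using one_dotProduct_indicatorVec J⟩
  by_cases h : i ∈ J <;> simp [indicatorVec_apply, h]

theorem le_affDim_hypersimplex {n k : ℕ} (hk : 1 ≤ k) (hkn : k + 1 ≤ n) :
    n ≤ affDim (hypersimplex k n) + 1 := by
  classical
  have hsum := finrank_add_finrank_annihilatorVec (vectorSpan ℝ (hypersimplex k n))
  have hle : annihilatorVec (vectorSpan ℝ (hypersimplex k n)) ≤
      Submodule.span ℝ {(1 : Fin n → ℝ)} := by
    intro u hu
    rw [mem_annihilatorVec] at hu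
    -- Some `k`-set contains `b` and avoids `a`, because `1 ≤ k ≤ n - 1`; exchanging the two shows
    -- that `e_a - e_b` is a direction of the hypersimplex.
    have key : ∀ a b, u a = u b := by
      intro a b
      by_cases hab : a = b
      · rw [hab]
      obtain ⟨J, hbJ, hJa, hcard⟩ := Finset.exists_subsuperset_card_eq
        (s := {b}) (t := Finset.univ.erase a) (n := k)
        (by simpa using Ne.symm hab) (by simpa using hk) (by simp; lia)
      have haJ : a ∉ J := fun h => by simpa using hJa h
      have hbJ : b ∈ J := hbJ (by simp)
      have h1 := indicatorVec_mem_hypersimplex J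
      have h2 := indicatorVec_mem_hypersimplex (insert a (J.erase b))
      have hc2 : (insert a (J.erase b)).card = k := by
        rw [Finset.card_insert_of_notMem (by simp [haJ]), Finset.card_erase_of_mem hbJ]
        lia
      rw [hc2] at h2
      rw [hcard] at h1
      have h3 := hu _ (vsub_mem_vectorSpan ℝ h2 h1)
      rw [Finset.coe_insert, Finset.coe_erase,
        vsub_eq_sub, dotProduct_sub, dotProduct_exchange u (by simpa) (by simpa)] at h3
      linarith
    rw [Submodule.mem_span_singleton]
    exact ⟨u ⟨0, by lia⟩, by ext i; simp [key i ⟨0, by lia⟩]⟩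
  have := Submodule.finrank_mono hle
  have h1 := finrank_span_le_card (R := ℝ) ({(1 : Fin n → ℝ)} : Set (Fin n → ℝ))
  simp only [Set.toFinset_singleton, Finset.card_singleton] at h1
  unfold affDim
  lia

/-! ### Facets of the cells and the sets defining them -/

/-- The properties of the maximal cells of a matroid subdivision at a common vertex `e_J`. -/
structure IsCellAt {n : ℕ} (k : ℝ) (J : Set (Fin n)) (Q : Set (Fin n → ℝ)) : Prop where
  convex : Convex ℝ Q
  mem : indicatorVec J ∈ Q
  sum : ∀ x ∈ Q, 1 ⬝ᵥ x = k
  dim : n ≤ affDim Q + 1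
  generated : LocallyGenerated Q J

/-- The hyperplane `x_A = |A ∩ J|` separates `Q` from `R` and cuts out `Q ∩ R` in both. -/
structure SeparatesAt {n : ℕ} (J A : Set (Fin n)) (Q R : Set (Fin n → ℝ)) : Prop where
  nonempty : A.Nonempty
  compl_nonempty : Aᶜ.Nonempty
  ge : ∀ x ∈ Q, indicatorVec A ⬝ᵥ indicatorVec J ≤ indicatorVec A ⬝ᵥ x
  le : ∀ x ∈ R, indicatorVec A ⬝ᵥ x ≤ indicatorVec A ⬝ᵥ indicatorVec J
  mem_right_iff : ∀ x ∈ Q, x ∈ R ↔ indicatorVec A ⬝ᵥ x = indicatorVec A ⬝ᵥ indicatorVec J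
  mem_left_iff : ∀ x ∈ R, x ∈ Q ↔ indicatorVec A ⬝ᵥ x = indicatorVec A ⬝ᵥ indicatorVec J

section

variable {n : ℕ} {k : ℝ} {J A B C : Set (Fin n)} {Q R T F : Set (Fin n → ℝ)}

theorem IsCellAt.indicatorVec_not_const (hQ : IsCellAt k J Q) (hA : A.Nonempty)
    (hA' : Aᶜ.Nonempty) {t : ℝ} (h : ∀ x ∈ Q, indicatorVec A ⬝ᵥ x = t) : False := by
  classical
  obtain ⟨i, hi⟩ := hA
  obtain ⟨j, hj⟩ := hA'
  have hj' : j ∉ A := hj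
  have := eq_of_const_on_fullDim (Nat.zero_lt_of_lt i.2) hQ.dim hQ.sum h i j
  simp [indicatorVec_apply, hi, hj'] at this

/-- A functional `w` exposing the facet is monotone along the exchanges available at `e_J`, and so
is any functional obtained by collapsing its level sets in order. Keeping only the distinction
between maximal and non-maximal values of `w` gives an indicator vector, which must define the same
facet by dimension. -/
theorem IsCellAt.exists_facet_normal (hQ : IsCellAt k J Q) (hF : IsFacet Q F)
    (hJF : indicatorVec J ∈ F) :
    ∃ A : Set (Fin n), A.Nonempty ∧ Aᶜ.Nonempty ∧
      (∀ x ∈ Q, indicatorVec A ⬝ᵥ indicatorVec J ≤ indicatorVec A ⬝ᵥ x) ∧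
      ∀ x ∈ Q, x ∈ F ↔ indicatorVec A ⬝ᵥ x = indicatorVec A ⬝ᵥ indicatorVec J := by
  classical
  obtain ⟨hne, hexp, hdimF⟩ := hF
  obtain ⟨l, hl⟩ := hexp hne
  have hdim2 : n ≤ affDim F + 2 := by have := hQ.dim; lia
  have hFQ : F ⊆ Q := by rw [hl]; exact fun x hx => hx.1
  have hnpos : 0 < n := by
    rcases Nat.eq_zero_or_pos n with rfl | h
    · exfalso
      have : F = Q := by
        ext x; exact ⟨fun h => hFQ h, fun _ => by convert hJF⟩
      rw [this] at hdimF; lia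
    · exact h
  obtain ⟨w, hw⟩ : ∃ w : Fin n → ℝ, ∀ x, l x = w ⬝ᵥ x :=
    ⟨(dotProductEquiv ℝ (Fin n)).symm l.toLinearMap, fun x => by
      have := (dotProductEquiv ℝ (Fin n)).apply_symm_apply l.toLinearMap
      exact (LinearMap.congr_fun this x).symm⟩
  have hmemF : ∀ x, x ∈ F ↔ x ∈ Q ∧ ∀ y ∈ Q, w ⬝ᵥ y ≤ w ⬝ᵥ x := fun x => by
    rw [hl]; simp [hw]
  have hmax := ((hmemF _).1 hJF).2
  have hFw : ∀ x ∈ Q, x ∈ F ↔ w ⬝ᵥ x = w ⬝ᵥ indicatorVec J := fun x hx =>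
    ⟨fun h => le_antisymm (hmax x hx) (((hmemF x).1 h).2 _ hQ.mem),
      fun h => (hmemF x).2 ⟨hx, fun y hy => h ▸ hmax y hy⟩⟩
  have harrow : ∀ a ∉ J, ∀ b ∈ J, indicatorVec (insert a (J \ {b})) ∈ Q → w a ≤ w b := by
    intro a ha b hb h
    have := hmax _ h
    rw [dotProduct_exchange w ha hb] at this
    linarith
  have : Nonempty (Fin n) := ⟨⟨0, hnpos⟩⟩
  obtain ⟨i₀, hi₀⟩ := Finite.exists_max w
  set A : Set (Fin n) := {i | w i < w i₀} with hAdef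
  have hAn : A.Nonempty := by
    by_contra hempty
    have hconst : w = w i₀ • 1 := by
      ext i
      have : i ∉ A := fun h => hempty ⟨i, h⟩
      simpa using le_antisymm (hi₀ i) (not_lt.1 this)
    have : F = Q := Set.Subset.antisymm hFQ fun x hx => by
      rw [hFw x hx, hconst, smul_dotProduct, smul_dotProduct, hQ.sum x hx, hQ.sum _ hQ.mem]
    rw [this] at hdimF; lia
  have hAc : Aᶜ.Nonempty := ⟨i₀, by simp [hAdef]⟩
  have hge : ∀ x ∈ Q, indicatorVec A ⬝ᵥ indicatorVec J ≤ indicatorVec A ⬝ᵥ x := by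
    intro x hx
    have := hQ.generated (-indicatorVec A) (fun a ha b hb h => by
      have h1 := harrow a ha b hb h
      by_cases haA : a ∈ A
      · by_cases hbA : b ∈ A <;> simp [indicatorVec_apply, haA, hbA]
      · have hbA : b ∉ A := fun hb' => haA (lt_of_le_of_lt h1 hb')
        simp [indicatorVec_apply, haA, hbA]) x hx
    simpa [neg_dotProduct] using this
  obtain ⟨i₁, hi₁, hi₁max⟩ := Set.exists_max_image A w (Set.toFinite _) hAn
  -- The gap between the two largest values of `w`. Raising `w` by `ε` on `A` creates no new
  -- inversion, so `w + ε • 1_A` is still maximal at `e_J`; this forces `x_A` to be constant on `F`.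
  set ε := w i₀ - w i₁ with hε
  have hεpos : 0 < ε := sub_pos.2 hi₁
  have hFA : ∀ x ∈ F, indicatorVec A ⬝ᵥ x = indicatorVec A ⬝ᵥ indicatorVec J := by
    intro x hx
    refine le_antisymm ?_ (hge x (hFQ hx))
    have := hQ.generated (w + ε • indicatorVec A) (fun a ha b hb h => by
      have h1 := harrow a ha b hb h
      by_cases haA : a ∈ A
      · by_cases hbA : b ∈ A
        · simpa [indicatorVec_apply, haA, hbA] using h1
        · have h2 := hi₁max a haA
          have h3 : w i₀ ≤ w b := not_lt.1 hbA
          simp [indicatorVec_apply, haA, hbA]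
          linarith
      · have hbA : b ∉ A := fun hb' => haA (lt_of_le_of_lt h1 hb')
        simpa [indicatorVec_apply, haA, hbA] using h1) x (hFQ hx)
    rw [add_dotProduct, add_dotProduct, smul_dotProduct, smul_dotProduct,
      (hFw x (hFQ hx)).1 hx, add_le_add_iff_left, smul_eq_mul, smul_eq_mul] at this
    exact le_of_mul_le_mul_left this hεpos
  refine ⟨A, hAn, hAc, hge, fun x hx => ⟨hFA x, fun hxA => ?_⟩⟩
  -- Conversely, `w` is constant on `F`, hence a combination of `1` and `1_A`, so fixing `x_A` fixes
  -- `w`.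
  obtain ⟨p, q, hpq⟩ := exists_of_const_on_facet hdim2 (fun x hx => hQ.sum x (hFQ hx)) hAn hAc hFA
    (u := w) (dotProduct_vectorSpan_eq_zero fun x hx => (hFw x (hFQ hx)).1 hx)
  rw [hFw x hx, hpq]
  simp only [add_dotProduct, smul_dotProduct]
  rw [hxA, hQ.sum x hx, hQ.sum _ hQ.mem]

/-- By convexity a sum of scaled differences can be averaged into one scaled difference. -/
theorem Convex.exists_smul_sub_of_mem_vectorSpan (hF : Convex ℝ F) (hne : F.Nonempty)
    {v : Fin n → ℝ} (hv : v ∈ vectorSpan ℝ F) :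
    ∃ t : ℝ, 0 ≤ t ∧ ∃ x ∈ F, ∃ y ∈ F, v = t • (x - y) := by
  obtain ⟨z, hz⟩ := hne
  rw [vectorSpan_def] at hv
  induction hv using Submodule.span_induction with
  | mem v hv =>
    obtain ⟨x, hx, y, hy, rfl⟩ := hv
    exact ⟨1, zero_le_one, x, hx, y, hy, by simp⟩
  | zero => exact ⟨0, le_rfl, z, hz, z, hz, by simp⟩
  | add v w _ _ hv hw =>
    obtain ⟨s, hs, x, hx, y, hy, rfl⟩ := hv
    obtain ⟨t, ht, x', hx', y', hy', rfl⟩ := hw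
    rcases (add_nonneg hs ht).eq_or_lt with h0 | hpos
    · have h1 : s = 0 := by linarith
      have h2 : t = 0 := by linarith
      exact ⟨0, le_rfl, z, hz, z, hz, by simp [h1, h2]⟩
    · refine ⟨s + t, hpos.le, (s / (s + t)) • x + (t / (s + t)) • x',
        hF hx hx' (by positivity) (by positivity) (by field_simp),
        (s / (s + t)) • y + (t / (s + t)) • y',
        hF hy hy' (by positivity) (by positivity) (by field_simp), ?_⟩
      ext i
      simp
      field_simp
      ring
  | smul a v _ hv =>
    obtain ⟨s, hs, x, hx, y, hy, rfl⟩ := hv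
    rcases le_total 0 a with h | h
    · exact ⟨a * s, mul_nonneg h hs, x, hx, y, hy, by rw [smul_smul]⟩
    · refine ⟨-a * s, mul_nonneg (by linarith) hs, y, hy, x, hx, ?_⟩
      ext i; simp; ring

theorem mem_vectorSpan_of_facet (hdim : n ≤ affDim F + 2) (hsum : ∀ x ∈ F, 1 ⬝ᵥ x = k)
    (hA : A.Nonempty) (hA' : Aᶜ.Nonempty) {r : ℝ} (hAF : ∀ x ∈ F, indicatorVec A ⬝ᵥ x = r)
    {v : Fin n → ℝ} (h1 : 1 ⬝ᵥ v = 0) (h2 : indicatorVec A ⬝ᵥ v = 0) : v ∈ vectorSpan ℝ F := by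
  by_contra hv
  obtain ⟨f, hfv, hf⟩ := Submodule.exists_dual_map_eq_bot_of_notMem hv inferInstance
  set u := (dotProductEquiv ℝ (Fin n)).symm f with hu
  have hfu : ∀ x, f x = u ⬝ᵥ x := fun x => by
    have := (dotProductEquiv ℝ (Fin n)).apply_symm_apply f
    exact (LinearMap.congr_fun this x).symm
  obtain ⟨p, q, hpq⟩ := exists_of_const_on_facet hdim hsum hA hA' hAF (u := u) fun x hx => by
    have : f x ∈ (vectorSpan ℝ F).map f := Submodule.mem_map_of_mem hx
    rw [hf, Submodule.mem_bot] at this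
    rw [← hfu, this]
  apply hfv
  rw [hfu, hpq, add_dotProduct, smul_dotProduct, smul_dotProduct, h1, h2]
  simp

/-- Two full-dimensional convex cells on the same side of the hyperplane of their common facet would
also meet off that hyperplane. -/
theorem IsCellAt.not_same_side (hQ : IsCellAt k J Q) (hR : IsCellAt k J R)
    (hF : IsFacet Q (Q ∩ R)) (hA : A.Nonempty) (hA' : Aᶜ.Nonempty)
    (hQA : ∀ x ∈ Q, indicatorVec A ⬝ᵥ indicatorVec J ≤ indicatorVec A ⬝ᵥ x)
    (hRA : ∀ x ∈ R, indicatorVec A ⬝ᵥ indicatorVec J ≤ indicatorVec A ⬝ᵥ x)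
    (hFA : ∀ x ∈ Q ∩ R, indicatorVec A ⬝ᵥ x = indicatorVec A ⬝ᵥ indicatorVec J) : False := by
  have hdim2 : n ≤ affDim (Q ∩ R) + 2 := by have := hQ.dim; have := hF.2.2; lia
  set c := indicatorVec J
  obtain ⟨q, hq, hqA⟩ : ∃ q ∈ Q, indicatorVec A ⬝ᵥ c < indicatorVec A ⬝ᵥ q := by
    by_contra! h
    exact hQ.indicatorVec_not_const hA hA' fun x hx => le_antisymm (h x hx) (hQA x hx)
  obtain ⟨r, hr, hrA⟩ : ∃ r ∈ R, indicatorVec A ⬝ᵥ c < indicatorVec A ⬝ᵥ r := by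
    by_contra! h
    exact hR.indicatorVec_not_const hA hA' fun x hx => le_antisymm (h x hx) (hRA x hx)
  set α := indicatorVec A ⬝ᵥ q - indicatorVec A ⬝ᵥ c with hα
  set β := indicatorVec A ⬝ᵥ r - indicatorVec A ⬝ᵥ c with hβ
  have hαpos : 0 < α := sub_pos.2 hqA
  have hβpos : 0 < β := sub_pos.2 hrA
  -- The weights bring `q'` and `r'` to the same height `αβ/(α+β)` above the hyperplane, so that `r'
  -- - q'` is parallel to the facet.
  set q' := (α / (α + β)) • c + (β / (α + β)) • q with hq'
  set r' := (β / (α + β)) • c + (α / (α + β)) • r with hr'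
  have hq'Q : q' ∈ Q := hQ.convex hQ.mem hq (by positivity) (by positivity) (by field_simp)
  have hr'R : r' ∈ R := hR.convex hR.mem hr (by positivity) (by positivity) (by field_simp; ring)
  have hqval : indicatorVec A ⬝ᵥ q' = indicatorVec A ⬝ᵥ c + α * β / (α + β) := by
    simp only [hq', dotProduct_add, dotProduct_smul, smul_eq_mul]
    have : indicatorVec A ⬝ᵥ q = indicatorVec A ⬝ᵥ c + α := by rw [hα]; ring
    rw [this]; field_simp; ring
  have hrval : indicatorVec A ⬝ᵥ r' = indicatorVec A ⬝ᵥ c + α * β / (α + β) := by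
    simp only [hr', dotProduct_add, dotProduct_smul, smul_eq_mul]
    have : indicatorVec A ⬝ᵥ r = indicatorVec A ⬝ᵥ c + β := by rw [hβ]; ring
    rw [this]; field_simp; ring
  have hmem : r' - q' ∈ vectorSpan ℝ (Q ∩ R) :=
    mem_vectorSpan_of_facet hdim2 (fun x hx => hQ.sum x hx.1) hA hA' hFA
      (by rw [dotProduct_sub, hQ.sum _ hq'Q, hR.sum _ hr'R, sub_self])
      (by rw [dotProduct_sub, hqval, hrval, sub_self])
  obtain ⟨t, ht, x, hx, y, hy, hxy⟩ :=
    (hQ.convex.inter hR.convex).exists_smul_sub_of_mem_vectorSpan hF.1 hmem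
  -- From `r' - q' = t (x - y)` it follows that `q' + t x = r' + t y`. Rescaled, this is a common
  -- point of `Q` and `R` at positive height.
  have hz : (1 / (1 + t)) • q' + (t / (1 + t)) • x = (1 / (1 + t)) • r' + (t / (1 + t)) • y := by
    have : r' = q' + t • (x - y) := by rw [← hxy]; abel
    rw [this]
    ext i; simp; field_simp; ring
  have hzQ : (1 / (1 + t)) • q' + (t / (1 + t)) • x ∈ Q :=
    hQ.convex hq'Q hx.1 (by positivity) (by positivity) (by field_simp)
  have hzR : (1 / (1 + t)) • q' + (t / (1 + t)) • x ∈ R := by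
    rw [hz]
    exact hR.convex hr'R hy.2 (by positivity) (by positivity) (by field_simp)
  have hval := hFA _ ⟨hzQ, hzR⟩
  simp only [dotProduct_add, dotProduct_smul, smul_eq_mul, hqval, hFA x hx] at hval
  have hpos : 0 < α * β / (α + β) := by positivity
  have h1t : (1 + t) ≠ 0 := by positivity
  have : (1 / (1 + t)) * (α * β / (α + β)) = 0 := by
    have h2 : (1 / (1 + t)) * (indicatorVec A ⬝ᵥ c) + (t / (1 + t)) * (indicatorVec A ⬝ᵥ c)
      = indicatorVec A ⬝ᵥ c := by field_simp
    linarith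
  have h3 : 0 < (1 / (1 + t)) * (α * β / (α + β)) := by positivity
  linarith

theorem IsCellAt.compl_dotProduct (hQ : IsCellAt k J Q) {x : Fin n → ℝ} (hx : x ∈ Q) :
    indicatorVec Aᶜ ⬝ᵥ x = k - indicatorVec A ⬝ᵥ x := by
  rw [indicatorVec_compl, sub_dotProduct, hQ.sum x hx]

/-- `A` and its complement are the only sets whose indicator is an affine function of that
of `A`. -/
theorem eq_or_eq_compl_of_indicatorVec (hB : B.Nonempty) (hB' : Bᶜ.Nonempty) {p q : ℝ}
    (h : indicatorVec B = p • 1 + q • indicatorVec A) : B = A ∨ B = Aᶜ := by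
  classical
  obtain ⟨i, hi⟩ := hB
  obtain ⟨j, hj⟩ := hB'
  have hj' : j ∉ B := hj
  have e : ∀ l, (if l ∈ B then (1 : ℝ) else 0) = p + q * (if l ∈ A then 1 else 0) := fun l => by
    have := congrFun h l
    simpa [indicatorVec_apply] using this
  have hi1 := e i
  have hj1 := e j
  simp only [hi, hj', if_true, if_false] at hi1 hj1
  by_cases hiA : i ∈ A <;> by_cases hjA : j ∈ A <;> simp [hiA, hjA] at hi1 hj1
  · linarith
  · left; ext l; have := e l; by_cases h1 : l ∈ B <;> by_cases h2 : l ∈ A <;>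
      simp [h1, h2] at this ⊢ <;> linarith
  · right; ext l; have := e l; by_cases h1 : l ∈ B <;> by_cases h2 : l ∈ A <;>
      simp [h1, h2] at this ⊢ <;> linarith
  · linarith

/-! ### Separating sets for two and for three cells -/

theorem IsCellAt.exists_separatesAt (hQ : IsCellAt k J Q) (hR : IsCellAt k J R)
    (hFQ : IsFacet Q (Q ∩ R)) (hFR : IsFacet R (Q ∩ R)) : ∃ A, SeparatesAt J A Q R := by
  have hJ : indicatorVec J ∈ Q ∩ R := ⟨hQ.mem, hR.mem⟩
  obtain ⟨A, hA, hA', hAQ, hAF⟩ := hQ.exists_facet_normal hFQ hJ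
  obtain ⟨B, hB, hB', hBR, hBF⟩ := hR.exists_facet_normal hFR hJ
  have hdim2 : n ≤ affDim (Q ∩ R) + 2 := by have := hQ.dim; have := hFQ.2.2; lia
  have hAc : ∀ x ∈ Q ∩ R, indicatorVec A ⬝ᵥ x = indicatorVec A ⬝ᵥ indicatorVec J :=
    fun x hx => (hAF x hx.1).1 hx
  obtain ⟨p, q, hpq⟩ := exists_of_const_on_facet hdim2 (fun x hx => hQ.sum x hx.1) hA hA' hAc
    (u := indicatorVec B) (dotProduct_vectorSpan_eq_zero fun x hx => (hBF x hx.2).1 hx)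
  rcases eq_or_eq_compl_of_indicatorVec hB hB' hpq with rfl | rfl
  · exact (hQ.not_same_side hR hFQ hA hA' hAQ hBR hAc).elim
  · refine ⟨A, hA, hA', hAQ, fun x hx => ?_, fun x hx => ?_, fun x hx => ?_⟩
    · have := hBR x hx
      rw [hR.compl_dotProduct hx, hR.compl_dotProduct hR.mem] at this
      linarith
    · rw [← hAF x hx]; exact ⟨fun h => ⟨hx, h⟩, fun h => h.2⟩
    · have := hBF x hx
      rw [hR.compl_dotProduct hx, hR.compl_dotProduct hR.mem] at this
      rw [show x ∈ Q ↔ x ∈ Q ∩ R from ⟨fun h => ⟨h, hx⟩, fun h => h.1⟩, this, sub_right_inj]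

theorem SeparatesAt.symm (h : SeparatesAt J A Q R) (hQ : IsCellAt k J Q) (hR : IsCellAt k J R) :
    SeparatesAt J Aᶜ R Q := by
  refine ⟨h.compl_nonempty, by rw [compl_compl]; exact h.nonempty, fun x hx => ?_, fun x hx => ?_,
    fun x hx => ?_, fun x hx => ?_⟩
  · rw [hR.compl_dotProduct hx, hR.compl_dotProduct hR.mem]; linarith [h.le x hx]
  · rw [hQ.compl_dotProduct hx, hQ.compl_dotProduct hQ.mem]; linarith [h.ge x hx]
  · rw [hR.compl_dotProduct hx, hR.compl_dotProduct hR.mem, sub_right_inj]; exact h.mem_left_iff x hx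
  · rw [hQ.compl_dotProduct hx, hQ.compl_dotProduct hQ.mem, sub_right_inj]
    exact h.mem_right_iff x hx

theorem SeparatesAt.ne (h : SeparatesAt J A Q R) (h' : SeparatesAt J B R T)
    (hR : IsCellAt k J R) : A ≠ B := by
  rintro rfl
  exact hR.indicatorVec_not_const h.nonempty h.compl_nonempty fun x hx =>
    le_antisymm (h.le x hx) (h'.ge x hx)

/-- It suffices that `u = 1_B + 1_C` is constant on the facet `Q ∩ R`, whose annihilator is spanned
by `1` and `1_A`. -/
theorem SeparatesAt.sum_eq_affine (hQ : IsCellAt k J Q)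
    (hF : IsFacet Q (Q ∩ R)) (hA : SeparatesAt J A Q R) (hB : SeparatesAt J B R T)
    (hC : SeparatesAt J C T Q) :
    ∃ p q : ℝ, indicatorVec A + indicatorVec B + indicatorVec C = p • 1 + q • indicatorVec A := by
  classical
  have hdim2 : n ≤ affDim (Q ∩ R) + 2 := by have := hQ.dim; have := hF.2.2; lia
  set c := indicatorVec J with hc
  set u : Fin n → ℝ := indicatorVec B + indicatorVec C with hu
  have hval : ∀ (D : Set (Fin n)) (i : Fin n), indicatorVec D i = 0 ∨ indicatorVec D i = 1 :=
    fun D i => by by_cases h : i ∈ D <;> simp [indicatorVec_apply, h]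
  have harrow : ∀ a ∉ J, ∀ b ∈ J, indicatorVec (insert a (J \ {b})) ∈ Q →
      indicatorVec A b ≤ indicatorVec A a ∧ (indicatorVec A a = indicatorVec A b → u a = u b) := by
    intro a ha b hb hp
    have hx := fun D : Set (Fin n) => dotProduct_exchange (indicatorVec D) ha hb
    set x := indicatorVec (insert a (J \ {b}))
    refine ⟨by have := hA.ge x hp; rw [hx] at this; linarith, fun hAab => ?_⟩
    have hxR : x ∈ R := (hA.mem_right_iff x hp).2 (by rw [hx, hAab]; ring)
    have hB1 := hB.ge x hxR
    have hC1 := hC.le x hp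
    -- An exchange point on `Q ∩ R` has its membership in `T` tested by `B` and by `C` alike. In `T`
    -- neither value changes; outside `T` the `B`-value rises by one and the `C`-value drops by one.
    -- In both cases `u` is preserved.
    have hTB : x ∈ T ↔ indicatorVec B a = indicatorVec B b := by
      rw [hB.mem_right_iff x hxR, hx]; constructor <;> intro h <;> linarith
    have hTC : x ∈ T ↔ indicatorVec C a = indicatorVec C b := by
      rw [hC.mem_left_iff x hp, hx]; constructor <;> intro h <;> linarith
    have hBC := hTB.symm.trans hTC
    rw [hx] at hB1 hC1
    simp only [hu, Pi.add_apply]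
    rcases hval B a with h1 | h1 <;> rcases hval B b with h2 | h2 <;>
      rcases hval C a with h3 | h3 <;> rcases hval C b with h4 | h4 <;>
      rw [h1, h2] at hB1 <;> rw [h3, h4] at hC1 <;> rw [h1, h2, h3, h4] at hBC ⊢ <;>
      norm_num at *
  have hub : ∀ a b, u a ≤ u b + 2 := fun a b => by
    simp only [hu, Pi.add_apply]
    rcases hval B a with h1 | h1 <;> rcases hval B b with h2 | h2 <;>
      rcases hval C a with h3 | h3 <;> rcases hval C b with h4 | h4 <;>
      rw [h1, h2, h3, h4] <;> norm_num
  have hle : ∀ s : ℝ, (s = 1 ∨ s = -1) → ∀ x ∈ Q ∩ R, s * (u ⬝ᵥ x) ≤ s * (u ⬝ᵥ c) := by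
    intro s hs x hx
    -- The values of `u` differ by at most 2, so the penalty `2 • 1_A` outweighs `± u` on exchanges
    -- leaving the facet; on `Q ∩ R` the penalty is constant.
    have := hQ.generated (s • u - (2 : ℝ) • indicatorVec A) (fun a ha b hb hp => by
      obtain ⟨h1, h2⟩ := harrow a ha b hb hp
      have h3 := hub a b
      have h4 := hub b a
      simp only [Pi.sub_apply, Pi.smul_apply, smul_eq_mul]
      rcases hval A a with h5 | h5 <;> rcases hval A b with h6 | h6 <;> rw [h5, h6] at h1 h2 ⊢
      · rw [h2 rfl]
      · norm_num at h1
      · rcases hs with rfl | rfl <;> linarith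
      · rw [h2 rfl]) x hx.1
    simp only [sub_dotProduct, smul_dotProduct, smul_eq_mul] at this
    rw [(hA.mem_right_iff x hx.1).1 hx.2] at this
    linarith
  obtain ⟨p, q, hpq⟩ := exists_of_const_on_facet hdim2 (fun x hx => hQ.sum x hx.1)
    hA.nonempty hA.compl_nonempty (fun x hx => (hA.mem_right_iff x hx.1).1 hx.2) (u := u)
    (dotProduct_vectorSpan_eq_zero (t := u ⬝ᵥ c) fun x hx => by
      have h1 := hle 1 (Or.inl rfl) x hx
      have h2 := hle (-1) (Or.inr rfl) x hx
      linarith)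
  exact ⟨p, q + 1, by rw [add_assoc, ← hu, hpq, add_smul, one_smul]; abel⟩

theorem SeparatesAt.sum_eq (hQ : IsCellAt k J Q) (hR : IsCellAt k J R) (hT : IsCellAt k J T)
    (hQR : IsFacet Q (Q ∩ R)) (hRT : IsFacet R (R ∩ T)) (hTQ : IsFacet T (T ∩ Q))
    (hA : SeparatesAt J A Q R) (hB : SeparatesAt J B R T) (hC : SeparatesAt J C T Q) :
    indicatorVec A + indicatorVec B + indicatorVec C = 1 ∨
      indicatorVec A + indicatorVec B + indicatorVec C = 2 := by
  classical
  obtain ⟨p, q, h1⟩ := hA.sum_eq_affine hQ hQR hB hC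
  obtain ⟨p', q', h2⟩ := hB.sum_eq_affine hR hRT hC hA
  obtain ⟨p'', q'', h3⟩ := hC.sum_eq_affine hT hTQ hA hB
  set s := indicatorVec A + indicatorVec B + indicatorVec C with hs
  have e2 : indicatorVec B + indicatorVec C + indicatorVec A = s := by rw [hs]; abel
  have e3 : indicatorVec C + indicatorVec A + indicatorVec B = s := by rw [hs]; abel
  rw [e2] at h2
  rw [e3] at h3
  obtain ⟨i, hi⟩ := hA.nonempty
  obtain ⟨j, hj⟩ := hA.compl_nonempty
  have hj' : j ∉ A := hj
  -- Otherwise `1_A` would be an affine function of `1_B` and of `1_C`. As `A` differs from `B` and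
  -- `C`, both would be the complement of `A`, yet `B ≠ C`.
  have hq : q = 0 := by
    by_contra hq
    have key : ∀ (D : Set (Fin n)) (a b : ℝ), s = a • 1 + b • indicatorVec D → A = D ∨ A = Dᶜ := by
      intro D a b h
      refine eq_or_eq_compl_of_indicatorVec (p := (a - p) / q) (q := b / q)
        hA.nonempty hA.compl_nonempty ?_
      rw [h1] at h
      ext l
      have := congrFun h l
      simp at this ⊢
      field_simp
      linarith
    have hAB := hA.ne hB hR
    have hBC := hB.ne hC hT
    have hCA := hC.ne hA hQ
    have hb := (key B _ _ h2).resolve_left hAB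
    have hc := (key C _ _ h3).resolve_left hCA.symm
    exact hBC (compl_injective (hb.symm.trans hc))
  subst hq
  have hconst : ∀ l, s l = p := fun l => by rw [h1]; simp
  have hsl : ∀ l, s l = (if l ∈ A then 1 else 0) + (if l ∈ B then 1 else 0) +
      (if l ∈ C then 1 else 0) := fun l => by simp [hs, indicatorVec_apply]
  have hi1 := hsl i
  have hj1 := hsl j
  rw [hconst] at hi1 hj1
  have hp : p = 1 ∨ p = 2 := by
    rw [if_pos hi] at hi1
    rw [if_neg hj'] at hj1
    split_ifs at hi1 hj1 <;> norm_num at hi1 hj1 <;>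
      first | (left; linarith) | (right; linarith)
  rcases hp with rfl | rfl
  · left; ext l; rw [hconst]; rfl
  · right; ext l; rw [hconst]; rfl

end

/-! ### The structure of multi-split matroid subdivisions -/

theorem one_dotProduct_of_mem_hypersimplex {n k : ℕ} {x : Fin n → ℝ} (hx : x ∈ hypersimplex k n) :
    1 ⬝ᵥ x = (k : ℝ) := by
  simpa [dotProduct] using hx.2

theorem convex_hypersimplex (k n : ℕ) : Convex ℝ (hypersimplex k n) := by
  rintro x ⟨hx, hx'⟩ y ⟨hy, hy'⟩ a b ha hb hab
  refine ⟨fun i => ⟨?_, ?_⟩, ?_⟩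
  · have := (hx i).1; have := (hy i).1
    simp only [Pi.add_apply, Pi.smul_apply, smul_eq_mul]; positivity
  · have h1 := mul_le_mul_of_nonneg_left (hx i).2 ha
    have h2 := mul_le_mul_of_nonneg_left (hy i).2 hb
    simp only [Pi.add_apply, Pi.smul_apply, smul_eq_mul]; linarith
  · simp only [Pi.add_apply, Pi.smul_apply, smul_eq_mul, Finset.sum_add_distrib,
      ← Finset.mul_sum, hx', hy', ← add_mul, hab, one_mul]

theorem indicatorVec_injective {n : ℕ} : Function.Injective (indicatorVec (n := n)) := by
  classical
  intro A B h
  ext i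
  have := congrFun h i
  by_cases hA : i ∈ A <;> by_cases hB : i ∈ B <;> simp [indicatorVec_apply, hA, hB] at this ⊢

theorem IsPolytope.isCompact {n : ℕ} {P : Set (Fin n → ℝ)} (hP : IsPolytope P) : IsCompact P := by
  obtain ⟨V, hV, rfl⟩ := hP
  exact hV.isCompact_convexHull ℝ

theorem IsPolytope.convex {n : ℕ} {P : Set (Fin n → ℝ)} (hP : IsPolytope P) : Convex ℝ P := by
  obtain ⟨V, -, rfl⟩ := hP
  exact convex_convexHull ℝ V

theorem IsSubdivision.isExtreme_sInter {n : ℕ} {P : Set (Fin n → ℝ)} {S : Set (Set (Fin n → ℝ))}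
    (hS : IsSubdivision P S) {Q : Set (Fin n → ℝ)} (hQ : Q ∈ S) : IsExtreme ℝ Q (⋂₀ S) := by
  refine ⟨Set.sInter_subset_of_mem hQ, fun x hx y hy z hz hzxy => ?_⟩
  intro R hR
  exact ((hS.face Q hQ R hR).1.isExtreme.left_mem_of_mem_openSegment hx hy
    ⟨hz Q hQ, hz R hR⟩ hzxy).2

/-- The maximal cells of a matroid subdivision with a common point have a common vertex. -/
theorem IsMatroidSubdivision.exists_isCellAt {n k : ℕ} (hk : 1 ≤ k) (hkn : k + 1 ≤ n)
    {S : Set (Set (Fin n → ℝ))} (hS : IsMatroidSubdivision (hypersimplex k n) S)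
    (hne : S.Nonempty) (hcommon : (⋂₀ S).Nonempty) :
    ∃ J : Set (Fin n), ∀ Q ∈ S, IsCellAt k J Q := by
  obtain ⟨Q₀, hQ₀⟩ := hne
  have hcomp : IsCompact (⋂₀ S) :=
    (hS.1.polytope Q₀ hQ₀).isCompact.of_isClosed_subset
      (isClosed_sInter fun Q hQ => (hS.1.polytope Q hQ).isCompact.isClosed)
      (Set.sInter_subset_of_mem hQ₀)
  -- An extreme point of the common intersection is extreme in every cell, because the intersection
  -- is an extreme subset of each.
  obtain ⟨p, hp⟩ := hcomp.extremePoints_nonempty hcommon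
  have hbase : ∀ Q ∈ S, ∃ M : Matroid (Fin n), ∃ B, M.IsBase B ∧ p = indicatorVec B ∧
      Q = convexHull ℝ {x | ∃ B : Set (Fin n), M.IsBase B ∧ x = indicatorVec B} := by
    intro Q hQ
    obtain ⟨M, -, hM⟩ := hS.2 Q hQ
    have hpQ := (hS.1.isExtreme_sInter hQ).extremePoints_subset_extremePoints hp
    rw [hM] at hpQ
    obtain ⟨B, hB, hpB⟩ := extremePoints_convexHull_subset hpQ
    exact ⟨M, B, hB, hpB, hM⟩
  obtain ⟨-, J, -, hpJ, -⟩ := hbase Q₀ hQ₀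
  refine ⟨J, fun Q hQ => ?_⟩
  obtain ⟨M, B, hB, hpB, hM⟩ := hbase Q hQ
  obtain rfl : J = B := indicatorVec_injective (hpJ.symm.trans hpB)
  refine ⟨(hS.1.polytope Q hQ).convex, ?_, fun x hx => ?_, ?_, ?_⟩
  · rw [← hpB]; exact hp.1 Q hQ
  · refine one_dotProduct_of_mem_hypersimplex ?_
    rw [← hS.1.cover]
    exact ⟨Q, hQ, hx⟩
  · rw [hS.1.dim_eq Q hQ]; exact le_affDim_hypersimplex hk hkn
  · rw [hM]; exact hB.locallyGenerated

theorem Convex.exists_forall_dotProduct_lt {n : ℕ} {Q : Set (Fin n → ℝ)} (hQ : Convex ℝ Q)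
    (hne : Q.Nonempty) {ι : Type*} (I : Finset ι) (u : ι → Fin n → ℝ) (t : ι → ℝ)
    (hle : ∀ i ∈ I, ∀ x ∈ Q, t i ≤ u i ⬝ᵥ x) (hlt : ∀ i ∈ I, ∃ x ∈ Q, t i < u i ⬝ᵥ x) :
    ∃ z ∈ Q, ∀ i ∈ I, t i < u i ⬝ᵥ z := by
  classical
  induction I using Finset.induction_on with
  | empty => obtain ⟨z, hz⟩ := hne; exact ⟨z, hz, by simp⟩
  | insert i I _ ih =>
    obtain ⟨z, hz, hzI⟩ := ih (fun j hj => hle j (Finset.mem_insert_of_mem hj))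
      (fun j hj => hlt j (Finset.mem_insert_of_mem hj))
    obtain ⟨x, hx, hxi⟩ := hlt i (Finset.mem_insert_self _ _)
    refine ⟨(1 / 2 : ℝ) • z + (1 / 2 : ℝ) • x, hQ hz hx (by norm_num) (by norm_num) (by norm_num),
      fun j hj => ?_⟩
    simp only [dotProduct_add, dotProduct_smul, smul_eq_mul]
    rcases Finset.mem_insert.1 hj with rfl | hj'
    · linarith [hle j hj z hz]
    · linarith [hle j hj x hx, hzI j hj']

theorem mem_closure_of_forall_lineMap_mem {n : ℕ} {U : Set (Fin n → ℝ)} {x z : Fin n → ℝ}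
    (h : ∀ s : ℝ, 0 < s → s ≤ 1 → AffineMap.lineMap x z s ∈ U) : x ∈ closure U := by
  have hcont : Filter.Tendsto (fun s : ℝ => AffineMap.lineMap x z s) (nhdsWithin 0 (Set.Ioi 0))
      (nhds x) := by
    have : Continuous (fun s : ℝ => AffineMap.lineMap x z s) := AffineMap.lineMap_continuous
    have h0 := this.tendsto 0
    rw [AffineMap.lineMap_apply_zero] at h0
    exact h0.mono_left nhdsWithin_le_nhds
  refine mem_closure_of_tendsto hcont ?_
  filter_upwards [Ioc_mem_nhdsGT (zero_lt_one' ℝ)] with s hs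
  exact h s hs.1 hs.2

theorem dotProduct_lineMap {n : ℕ} (u x z : Fin n → ℝ) (s : ℝ) :
    u ⬝ᵥ AffineMap.lineMap x z s = (1 - s) * (u ⬝ᵥ x) + s * (u ⬝ᵥ z) := by
  rw [AffineMap.lineMap_apply_module, dotProduct_add, dotProduct_smul, dotProduct_smul]
  rfl

/-- The cells of a subdivision of the hypersimplex are the regions where one of the functionals
`x ↦ x_A - |A ∩ J|`, for `A` in the chain `N`, is minimal. -/
structure IsChainSubdivision {n : ℕ} (k : ℕ) (S : Set (Set (Fin n → ℝ))) (J : Set (Fin n))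
    (N : Set (Fin n → ℝ) → Set (Fin n)) : Prop where
  isCellAt : ∀ Q ∈ S, IsCellAt k J Q
  exists_empty : ∃ Q ∈ S, N Q = ∅
  compl_nonempty : ∀ Q ∈ S, (N Q)ᶜ.Nonempty
  chain : ∀ Q ∈ S, ∀ R ∈ S, N Q ⊆ N R ∨ N R ⊆ N Q
  mem_iff : ∀ Q ∈ S, ∀ x, x ∈ Q ↔ x ∈ hypersimplex k n ∧ ∀ R ∈ S,
    indicatorVec (N Q) ⬝ᵥ (x - indicatorVec J) ≤ indicatorVec (N R) ⬝ᵥ (x - indicatorVec J)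

theorem IsMatroidSubdivision.exists_isChainSubdivision {n k : ℕ} (hk : 1 ≤ k) (hkn : k + 1 ≤ n)
    {S : Set (Set (Fin n → ℝ))} (hS : IsMatroidSubdivision (hypersimplex k n) S)
    (hne : S.Nonempty) (hcommon : (⋂₀ S).Nonempty)
    (hfacet : ∀ Q ∈ S, ∀ R ∈ S, Q ≠ R → IsFacet Q (Q ∩ R) ∧ IsFacet R (Q ∩ R)) :
    ∃ J N, IsChainSubdivision k S J N := by
  classical
  obtain ⟨J, hcell⟩ := hS.exists_isCellAt hk hkn hne hcommon
  obtain ⟨Q₀, hQ₀⟩ := hne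
  have hsep : ∀ Q ∈ S, ∀ R ∈ S, Q ≠ R → ∃ A, SeparatesAt J A Q R := fun Q hQ R hR hQR =>
    (hcell Q hQ).exists_separatesAt (hcell R hR) (hfacet Q hQ R hR hQR).1 (hfacet Q hQ R hR hQR).2
  choose! D hD using hsep
  set N : Set (Fin n → ℝ) → Set (Fin n) := fun R => if R = Q₀ then ∅ else D Q₀ R with hN
  have hN0 : N Q₀ = ∅ := if_pos rfl
  have hN1 : ∀ R ∈ S, R ≠ Q₀ → SeparatesAt J (N R) Q₀ R := fun R hR hne => by
    simp only [hN, if_neg hne]; exact hD Q₀ hQ₀ R hR hne.symm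
  have hind0 : indicatorVec (∅ : Set (Fin n)) = 0 := by ext i; simp [indicatorVec]
  -- The three-cell relation for `Q₀`, `Q`, `R`. The two cases are the two possible sums; they yield
  -- `N Q ⊆ N R` and `N R ⊆ N Q` respectively, and the extra `1` vanishes on differences of points
  -- of the hypersimplex.
  have key : ∀ Q ∈ S, ∀ R ∈ S, Q ≠ R → ∃ B, SeparatesAt J B Q R ∧
      (indicatorVec (N R) - indicatorVec (N Q) = indicatorVec B ∨
        indicatorVec (N R) - indicatorVec (N Q) = indicatorVec B - 1) := by
    intro Q hQ R hR hQR
    by_cases h1 : Q = Q₀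
    · subst h1
      exact ⟨N R, hN1 R hR hQR.symm, Or.inl (by rw [hN0, hind0, sub_zero])⟩
    by_cases h2 : R = Q₀
    · subst h2
      refine ⟨(N Q)ᶜ, (hN1 Q hQ h1).symm (hcell _ hR) (hcell _ hQ), Or.inr ?_⟩
      rw [hN0, hind0, indicatorVec_compl]; abel
    have hA := hN1 Q hQ h1
    have hB := hD Q hQ R hR hQR
    have hC := (hN1 R hR h2).symm (hcell _ hQ₀) (hcell _ hR)
    refine ⟨_, hB, ?_⟩
    have := hA.sum_eq (hcell _ hQ₀) (hcell _ hQ) (hcell _ hR) (hfacet _ hQ₀ _ hQ (Ne.symm h1)).1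
      (hfacet _ hQ _ hR hQR).1 (hfacet _ hR _ hQ₀ h2).1 hB hC
    rw [indicatorVec_compl] at this
    rcases this with h | h
    · left
      ext i
      have := congrFun h i
      simp only [Pi.add_apply, Pi.sub_apply, Pi.one_apply] at this ⊢
      linarith
    · right
      ext i
      have := congrFun h i
      simp only [Pi.add_apply, Pi.sub_apply, Pi.ofNat_apply] at this ⊢
      linarith
  have key2 : ∀ Q ∈ S, ∀ R ∈ S, Q ≠ R → ∃ B, SeparatesAt J B Q R ∧ ∀ x, 1 ⬝ᵥ x = (k : ℝ) →
      indicatorVec (N R) ⬝ᵥ (x - indicatorVec J) - indicatorVec (N Q) ⬝ᵥ (x - indicatorVec J) =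
        indicatorVec B ⬝ᵥ x - indicatorVec B ⬝ᵥ indicatorVec J := by
    intro Q hQ R hR hQR
    obtain ⟨B, hB, h⟩ := key Q hQ R hR hQR
    refine ⟨B, hB, fun x hx => ?_⟩
    have h1 : 1 ⬝ᵥ (x - indicatorVec J) = 0 := by
      rw [dotProduct_sub, hx, (hcell Q hQ).sum _ (hcell Q hQ).mem, sub_self]
    rw [← sub_dotProduct, ← dotProduct_sub]
    rcases h with h | h <;> rw [h]
    rw [sub_dotProduct, h1, sub_zero]
  have hsub : ∀ Q ∈ S, Q ⊆ hypersimplex k n := fun Q hQ x hx => by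
    rw [← hS.1.cover]; exact ⟨Q, hQ, hx⟩
  refine ⟨J, N, hcell, ⟨Q₀, hQ₀, hN0⟩, fun Q hQ => ?_, fun Q hQ R hR => ?_, fun Q hQ x => ?_⟩
  · by_cases h : Q = Q₀
    · rw [h, hN0, Set.compl_empty]; exact ⟨⟨0, by lia⟩, trivial⟩
    · exact (hN1 Q hQ h).compl_nonempty
  · by_cases hQR : Q = R
    · subst hQR; exact Or.inl subset_rfl
    obtain ⟨B, -, h | h⟩ := key Q hQ R hR hQR
    · left; intro i hi
      by_contra hi'
      have := congrFun h i
      by_cases hB : i ∈ B <;> simp [indicatorVec_apply, hi, hi', hB] at this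
      linarith
    · right; intro i hi
      by_contra hi'
      have := congrFun h i
      by_cases hB : i ∈ B <;> simp [indicatorVec_apply, hi, hi', hB] at this
      linarith
  · constructor
    · refine fun hx => ⟨hsub Q hQ hx, fun R hR => ?_⟩
      by_cases hQR : Q = R
      · rw [hQR]
      obtain ⟨B, hB, h⟩ := key2 Q hQ R hR hQR
      have := h x ((hcell Q hQ).sum x hx)
      linarith [hB.ge x hx]
    · rintro ⟨hx, hmin⟩
      choose! B hB hBeq using key2 Q hQ
      have hc := hcell Q hQ
      have hmemI : ∀ R, R ∈ hS.1.finite.toFinset.erase Q ↔ R ≠ Q ∧ R ∈ S := by simp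
      obtain ⟨z, hz, hzlt⟩ := hc.convex.exists_forall_dotProduct_lt ⟨_, hc.mem⟩
        (hS.1.finite.toFinset.erase Q) (fun R => indicatorVec (B R))
        (fun R => indicatorVec (B R) ⬝ᵥ indicatorVec J)
        (fun R hR y hy => by
          obtain ⟨h1, h2⟩ := (hmemI R).1 hR
          exact (hB R h2 h1.symm).ge y hy)
        (fun R hR => by
          obtain ⟨h1, h2⟩ := (hmemI R).1 hR
          have hBR := hB R h2 h1.symm
          by_contra! hcon
          exact hc.indicatorVec_not_const hBR.nonempty hBR.compl_nonempty
            fun y hy => le_antisymm (hcon y hy) (hBR.ge y hy))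
      have hcl : IsClosed Q := (hS.1.polytope Q hQ).isCompact.isClosed
      rw [← hcl.closure_eq]
      -- The point `z` of `Q` is strictly on its side of every separating hyperplane and `x` is
      -- weakly so. Thus every point of the segment other than `x` is strictly inside, belongs to no
      -- other cell, and lies in `Q`.
      refine mem_closure_of_forall_lineMap_mem (z := z) fun s hs hs1 => ?_
      have hmem : AffineMap.lineMap x z s ∈ hypersimplex k n :=
        (convex_hypersimplex k n).lineMap_mem hx (hsub Q hQ hz) ⟨hs.le, hs1⟩
      obtain ⟨R, hR, hxR⟩ := (hS.1.cover ▸ hmem : AffineMap.lineMap x z s ∈ ⋃₀ S)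
      by_cases hRQ : R = Q
      · exact hRQ ▸ hxR
      exfalso
      have h1 := (hB R hR (Ne.symm hRQ)).le _ hxR
      have h2 := hzlt R ((hmemI R).2 ⟨hRQ, hR⟩)
      have h3 := hBeq R hR (Ne.symm hRQ) x (one_dotProduct_of_mem_hypersimplex hx)
      have h4 := hmin R hR
      rw [dotProduct_lineMap] at h1
      have h5 : 0 ≤ (1 - s) * (indicatorVec (B R) ⬝ᵥ x - indicatorVec (B R) ⬝ᵥ indicatorVec J) :=
        mul_nonneg (by linarith) (by linarith)
      have h6 := mul_lt_mul_of_pos_left h2 hs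
      linarith

/-! ### Blades in terms of prefix sums -/

section

variable {n : ℕ} [NeZero n]

/-- The prefix sums of `y` along the cyclic order `σ`. -/
def prefixSum (σ : Equiv.Perm (Fin n)) (y : Fin n → ℝ) (m : ℕ) : ℝ :=
  ∑ p ∈ Finset.range m, y (σ (Fin.ofNat n p))

theorem prefixSum_succ (σ : Equiv.Perm (Fin n)) (y : Fin n → ℝ) (m : ℕ) :
    prefixSum σ y (m + 1) = prefixSum σ y m + y (σ (Fin.ofNat n m)) :=
  Finset.sum_range_succ _ _

theorem prefixSum_add_smul (σ : Equiv.Perm (Fin n)) (y z : Fin n → ℝ) (t : ℝ) (m : ℕ) :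
    prefixSum σ (y + t • z) m = prefixSum σ y m + t * prefixSum σ z m := by
  simp [prefixSum, Finset.sum_add_distrib, Finset.mul_sum]

theorem continuous_prefixSum (σ : Equiv.Perm (Fin n)) (m : ℕ) :
    Continuous fun y => prefixSum σ y m := by
  unfold prefixSum; fun_prop

theorem Fin.ofNat_val_self (p : Fin n) : Fin.ofNat n p = p :=
  Fin.ext (Nat.mod_eq_of_lt p.2)

theorem prefixSum_eq_sum_ite (σ : Equiv.Perm (Fin n)) (y : Fin n → ℝ) {m : ℕ} (hm : m ≤ n) :
    prefixSum σ y m = ∑ p : Fin n, if (p : ℕ) < m then y (σ p) else 0 := by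
  have h := Fin.sum_univ_eq_sum_range
    (fun p => if p < m then y (σ (Fin.ofNat n p)) else 0) n
  simp only [Fin.ofNat_val_self] at h
  rw [h, ← Finset.sum_filter, prefixSum]
  congr 1
  ext p
  simp only [Finset.mem_range, Finset.mem_filter]
  lia

theorem prefixSum_self (σ : Equiv.Perm (Fin n)) (y : Fin n → ℝ) :
    prefixSum σ y n = ∑ i, y i := by
  rw [prefixSum_eq_sum_ite σ y le_rfl, ← Equiv.sum_comp σ y]
  simp

theorem prefixSum_add_period (σ : Equiv.Perm (Fin n)) {y : Fin n → ℝ} (hy : ∑ i, y i = 0)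
    (m : ℕ) : prefixSum σ y (n + m) = prefixSum σ y m := by
  have h : prefixSum σ y (n + m) = prefixSum σ y n +
      ∑ p ∈ Finset.range m, y (σ (Fin.ofNat n (n + p))) := Finset.sum_range_add _ _ _
  rw [h, prefixSum_self, hy, zero_add]
  refine Finset.sum_congr rfl fun p _ => ?_
  congr 2
  exact Fin.ext (by simp [Fin.ofNat])

theorem finRotate_pow_apply (j : ℕ) (a : Fin n) :
    (finRotate n ^ j) a = Fin.ofNat n (j + a) := by
  induction j with
  | zero => simp
  | succ j ih =>
    rw [pow_succ', Equiv.Perm.mul_apply, ih, finRotate_apply]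
    apply Fin.ext
    simp [Fin.val_add, Fin.ofNat, add_right_comm]

theorem sum_Iic_rotate (σ : Equiv.Perm (Fin n)) (y : Fin n → ℝ) (j : ℕ) (m : Fin n) :
    ∑ a ∈ Finset.Iic m, ∑ i ∈ ({σ ((finRotate n ^ j) a)} : Finset (Fin n)), y i =
      prefixSum σ y (j + (m + 1)) - prefixSum σ y j := by
  have h : prefixSum σ y (j + (m + 1)) = prefixSum σ y j +
      ∑ p ∈ Finset.range (m + 1), y (σ (Fin.ofNat n (j + p))) := Finset.sum_range_add _ _ _
  rw [h, add_sub_cancel_left]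
  refine Finset.sum_nbij (fun a => (a : ℕ)) ?_ ?_ ?_ ?_
  · intro a ha
    have : a ≤ m := by simpa using ha
    simpa [Nat.lt_succ_iff] using this
  · exact fun a _ b _ h => Fin.ext h
  · intro p hp
    have hp' : p < m + 1 := by simpa using hp
    exact ⟨⟨p, by have := m.2; lia⟩, by simpa [Fin.le_def] using Nat.lt_succ_iff.1 hp', rfl⟩
  · intro a _
    rw [Finset.sum_singleton, finRotate_pow_apply]

/-- The cyclic rotation starting at position `j` of the plate of the order `σ`. -/
def rotatedPlate (σ : Equiv.Perm (Fin n)) (j : ℕ) : Set (Fin n → ℝ) :=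
  plate (fun a => {σ ((finRotate n ^ j) a)}) (fun _ => 0)

theorem mem_rotatedPlate_iff (σ : Equiv.Perm (Fin n)) {j : ℕ} (hj : j < n) (y : Fin n → ℝ) :
    y ∈ rotatedPlate σ j ↔
      ∑ i, y i = 0 ∧ ∀ m < n, prefixSum σ y j ≤ prefixSum σ y m := by
  simp only [rotatedPlate, plate, Set.mem_ofPred_eq, sum_Iic_rotate, Finset.sum_const_zero,
    Int.cast_zero, sub_nonneg]
  refine and_congr_right fun hy => ⟨fun h m hm => ?_, fun h m hm => ?_⟩
  · rcases lt_trichotomy m j with h1 | rfl | h1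
    -- Positions before `j` are reached by wrapping around: as the total is zero, the prefix sum at
    -- `m` equals that at `n + m`.
    · have := h ⟨n + m - j - 1, by lia⟩ (by simp only; lia)
      rwa [show j + ((n + m - j - 1) + 1) = n + m by lia, prefixSum_add_period σ hy] at this
    · exact le_rfl
    · have := h ⟨m - j - 1, by lia⟩ (by simp only; lia)
      rwa [show j + ((m - j - 1) + 1) = m by lia] at this
  · rcases lt_or_ge (j + (m + 1)) n with h1 | h1
    · exact h _ h1
    · have := h (j + (m + 1) - n) (by lia)
      rwa [← prefixSum_add_period σ hy (j + (m + 1) - n),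
        show n + (j + (m + 1) - n) = j + (m + 1) by lia] at this

theorem isClosed_rotatedPlate (σ : Equiv.Perm (Fin n)) {j : ℕ} (hj : j < n) :
    IsClosed (rotatedPlate σ j) := by
  have : rotatedPlate σ j = {y | ∑ i, y i = 0} ∩
      ⋂ m, ⋂ (_ : m < n), {y | prefixSum σ y j ≤ prefixSum σ y m} := by
    ext y; simp [mem_rotatedPlate_iff σ hj]
  rw [this]
  refine (isClosed_eq (by fun_prop) continuous_const).inter ?_
  exact isClosed_iInter fun m => isClosed_iInter fun _ =>
    isClosed_le (continuous_prefixSum σ j) (continuous_prefixSum σ m)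

/-- A direction pointing from the boundary into the rotated plate. -/
theorem exists_prefixSum_eq_one (σ : Equiv.Perm (Fin n)) {j : ℕ} (hj : j < n) :
    ∃ z : Fin n → ℝ, ∑ i, z i = 0 ∧
      ∀ m < n, m ≠ j → prefixSum σ z m = prefixSum σ z j + 1 := by
  -- Prescribed prefix sums up to a constant: a dip at position `j`. The coordinates of `z` are its
  -- successive differences.
  set v : ℕ → ℝ := fun p => if p % n = j then -1 else 0 with hv
  set z : Fin n → ℝ := fun i => v ((σ.symm i : ℕ) + 1) - v (σ.symm i) with hz
  have hG : ∀ m, prefixSum σ z m = v m - v 0 := by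
    intro m
    rw [prefixSum, ← Finset.sum_range_sub]
    refine Finset.sum_congr rfl fun p _ => ?_
    simp [hz, hv, Fin.ofNat]
  refine ⟨z, ?_, fun m hm hmj => ?_⟩
  · rw [← prefixSum_self σ z, hG, sub_eq_zero]
    exact if_congr (by simp) rfl rfl
  · rw [hG, hG]
    simp only [hv, Nat.mod_eq_of_lt hm, Nat.mod_eq_of_lt hj, hmj, if_true, if_false]
    ring

theorem mem_intrinsicInterior_rotatedPlate_iff (σ : Equiv.Perm (Fin n)) {j : ℕ} (hj : j < n)
    (y : Fin n → ℝ) : y ∈ intrinsicInterior ℝ (rotatedPlate σ j) ↔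
      ∑ i, y i = 0 ∧ ∀ m < n, m ≠ j → prefixSum σ y j < prefixSum σ y m := by
  constructor
  · intro hy
    have hyP := (mem_rotatedPlate_iff σ hj y).1 (intrinsicInterior_subset hy)
    refine ⟨hyP.1, fun m hm hmj => lt_of_le_of_ne (hyP.2 m hm) fun heq => ?_⟩
    -- At a tie, a small step along `-z` stays in the affine span but makes the `j`-th prefix sum
    -- exceed the `m`-th.
    obtain ⟨z, hz, hzm⟩ := exists_prefixSum_eq_one σ hj
    obtain ⟨y', hy', rfl⟩ := mem_intrinsicInterior.1 hy
    have hyz : (y' : Fin n → ℝ) + (1 : ℝ) • z ∈ rotatedPlate σ j := by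
      rw [mem_rotatedPlate_iff σ hj]
      refine ⟨by simp [Finset.sum_add_distrib, hyP.1, hz], fun m hm => ?_⟩
      rw [prefixSum_add_smul, prefixSum_add_smul]
      have := hyP.2 m hm
      by_cases h : m = j
      · rw [h]
      · rw [hzm m hm h]; linarith
    let f : ℝ → affineSpan ℝ (rotatedPlate σ j) := fun t =>
      ⟨AffineMap.lineMap (y' : Fin n → ℝ) ((y' : Fin n → ℝ) + (1 : ℝ) • z) t,
        AffineMap.lineMap_mem t y'.2 (subset_affineSpan ℝ _ hyz)⟩
    have hf : Continuous f := Continuous.subtype_mk AffineMap.lineMap_continuous _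
    have hf0 : f 0 = y' := Subtype.ext (AffineMap.lineMap_apply_zero _ _)
    have hopen := isOpen_interior.preimage hf
      (t := interior ((↑) ⁻¹' rotatedPlate σ j : Set (affineSpan ℝ (rotatedPlate σ j))))
    obtain ⟨ε, hε, hball⟩ := Metric.isOpen_iff.1 hopen 0 (by rw [Set.mem_preimage, hf0]; exact hy')
    have hmem : f (-(ε / 2)) ∈ interior
        ((↑) ⁻¹' rotatedPlate σ j : Set (affineSpan ℝ (rotatedPlate σ j))) :=
      hball (by rw [Metric.mem_ball, dist_zero_right, norm_neg, Real.norm_of_nonneg (by linarith)]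
                linarith)
    have hmem' : (f (-(ε / 2)) : Fin n → ℝ) ∈ rotatedPlate σ j :=
      interior_subset (s := Subtype.val ⁻¹' rotatedPlate σ j) hmem
    have hfe : (f (-(ε / 2)) : Fin n → ℝ) = (y' : Fin n → ℝ) + (-(ε / 2)) • z := by
      simp only [f, AffineMap.lineMap_apply_module]
      ext i; simp; ring
    rw [hfe, mem_rotatedPlate_iff σ hj] at hmem'
    have := hmem'.2 m hm
    rw [prefixSum_add_smul, prefixSum_add_smul, hzm m hm hmj, heq] at this
    linarith
  · rintro ⟨hy, hlt⟩
    have hyP : y ∈ rotatedPlate σ j := (mem_rotatedPlate_iff σ hj y).2 ⟨hy, fun m hm => by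
      by_cases h : m = j
      · rw [h]
      · exact (hlt m hm h).le⟩
    refine mem_intrinsicInterior.2 ⟨⟨y, subset_affineSpan ℝ _ hyP⟩, ?_, rfl⟩
    set U : Set (Fin n → ℝ) := ⋂ m ∈ (Finset.range n).erase j,
      {x | prefixSum σ x j < prefixSum σ x m} with hU
    have hUopen : IsOpen U := isOpen_biInter_finset fun m _ =>
      isOpen_lt (continuous_prefixSum σ j) (continuous_prefixSum σ m)
    have hmemU : ∀ x, x ∈ U ↔ ∀ m < n, m ≠ j → prefixSum σ x j < prefixSum σ x m := fun x => by
      simp only [hU, Set.mem_iInter, Finset.mem_erase, Finset.mem_range, Set.mem_ofPred_eq]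
      exact ⟨fun h m h1 h2 => h m ⟨h2, h1⟩, fun h m h1 => h m h1.2 h1.1⟩
    refine mem_interior.2 ⟨Subtype.val ⁻¹' U, fun x hx => ?_, hUopen.preimage continuous_subtype_val,
      show y ∈ U from (hmemU y).2 hlt⟩
    have hx' := (hmemU x).1 hx
    refine (mem_rotatedPlate_iff σ hj x).2 ⟨?_, fun m hm => ?_⟩
    · have hspan : affineSpan ℝ (rotatedPlate σ j) ≤
          (LinearMap.ker (∑ i, LinearMap.proj i : (Fin n → ℝ) →ₗ[ℝ] ℝ)).toAffineSubspace := by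
        refine affineSpan_le.2 fun w hw => ?_
        have := ((mem_rotatedPlate_iff σ hj w).1 hw).1
        simpa using this
      have := hspan x.2
      simpa using this
    · by_cases h : m = j
      · rw [h]
      · exact (hx' m hm h).le

/-- The rotated plate at `j` is where the `j`-th prefix sum is minimal, and its relative interior is
where it is the only minimum. Some prefix sum is always minimal, so lying on a boundary means that
the minimum is tied. -/
theorem mem_cyclicBlade_iff (σ : Equiv.Perm (Fin n)) {y : Fin n → ℝ} (hy : ∑ i, y i = 0) :
    y ∈ cyclicBlade σ ↔ ¬ ∃ j < n, ∀ m < n, m ≠ j → prefixSum σ y j < prefixSum σ y m := by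
  have hfr : ∀ j < n, intrinsicFrontier ℝ (rotatedPlate σ j) =
      rotatedPlate σ j \ intrinsicInterior ℝ (rotatedPlate σ j) := fun j hj => by
    rw [← intrinsicClosure_sdiff_intrinsicInterior,
      IsClosed.intrinsicClosure ((isClosed_rotatedPlate σ hj).preimage continuous_subtype_val)]
  have hmem : y ∈ cyclicBlade σ ↔ ∃ j : Fin n, y ∈ intrinsicFrontier ℝ (rotatedPlate σ j) := by
    simp only [cyclicBlade, blade, Set.mem_iUnion]
    rfl
  rw [hmem]
  constructor
  · rintro ⟨j, hj⟩ ⟨l, hl, hlt⟩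
    rw [hfr j j.2, Set.mem_sdiff, mem_rotatedPlate_iff σ j.2,
      mem_intrinsicInterior_rotatedPlate_iff σ j.2] at hj
    by_cases h : (j : ℕ) = l
    · exact hj.2 ⟨hy, fun m hm hmj => by rw [h]; exact hlt m hm (h ▸ hmj)⟩
    · exact absurd (hj.1.2 l hl) (not_le.2 (hlt j j.2 h))
  · intro h
    obtain ⟨j, hj⟩ := Finite.exists_min fun j : Fin n => prefixSum σ y j
    refine ⟨j, ?_⟩
    rw [hfr j j.2, Set.mem_sdiff, mem_rotatedPlate_iff σ j.2,
      mem_intrinsicInterior_rotatedPlate_iff σ j.2]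
    exact ⟨⟨hy, fun m hm => hj ⟨m, hm⟩⟩, fun hcon => h ⟨j, j.2, hcon.2⟩⟩

end

/-! ### The cyclic order of a chain of sets -/

/-- Given a finite chain of sets `N Q` and a set `J`, there is an ordering in which the members
of the chain are initial segments, and any element of `J` immediately followed by an element
outside `J` ends one of them. -/
theorem exists_perm_of_chain {n : ℕ} {ι : Type*} {S : Set ι} (hS : S.Finite) (N : ι → Set (Fin n))
    (J : Set (Fin n)) (hchain : ∀ Q ∈ S, ∀ R ∈ S, N Q ⊆ N R ∨ N R ⊆ N Q)
    (hproper : ∀ Q ∈ S, (N Q)ᶜ.Nonempty) :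
    ∃ (σ : Equiv.Perm (Fin n)) (M : ι → ℕ),
      (∀ Q ∈ S, M Q < n ∧ ∀ p : Fin n, σ p ∈ N Q ↔ (p : ℕ) < M Q) ∧
      ∀ p q : Fin n, (q : ℕ) = p + 1 → σ p ∈ J → σ q ∉ J → ∃ Q ∈ S, M Q = q := by
  classical
  set b : Fin n → ℕ := fun i => {Q ∈ S | i ∉ N Q}.ncard with hb
  -- Sorting by the number of members of the chain that miss `i` makes those members initial
  -- segments; the factor 2 leaves room for membership in `J` to break ties, with elements outside
  -- `J` first.
  set key : Fin n → ℕ := fun i => 2 * b i + if i ∈ J then 1 else 0 with hkey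
  have hmono : ∀ p q, p ≤ q → key (Tuple.sort key p) ≤ key (Tuple.sort key q) := fun p q h =>
    Tuple.monotone_sort key h
  set σ := Tuple.sort key
  have hblt : ∀ Q ∈ S, ∀ i i', i ∈ N Q → i' ∉ N Q → b i < b i' := by
    intro Q hQ i i' hi hi'
    refine Set.ncard_lt_ncard ⟨fun R hR => ⟨hR.1, fun hi'R => ?_⟩, fun hsub => ?_⟩
      (hS.subset fun R hR => hR.1)
    · rcases hchain Q hQ R hR.1 with h | h
      · exact hR.2 (h hi)
      · exact hi' (h hi'R)
    · exact (hsub ⟨hQ, hi'⟩).2 hi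
  have hbex : ∀ i i', b i < b i' → ∃ Q ∈ S, i ∈ N Q ∧ i' ∉ N Q := by
    intro i i' h
    by_contra! hcon
    have hsub : {Q ∈ S | i' ∉ N Q} ⊆ {Q ∈ S | i ∉ N Q} :=
      fun R hR => ⟨hR.1, fun hi => hR.2 (hcon R hR.1 hi)⟩
    exact absurd (Set.ncard_le_ncard hsub (hS.subset fun R hR => hR.1)) (not_le.2 h)
  have hinit : ∀ Q ∈ S, ∃ m < n, ∀ p : Fin n, σ p ∈ N Q ↔ (p : ℕ) < m := by
    intro Q hQ
    obtain ⟨i, hi⟩ := hproper Q hQ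
    have hex : ∃ m, ∃ h : m < n, σ ⟨m, h⟩ ∉ N Q :=
      ⟨σ.symm i, (σ.symm i).2, by simpa using hi⟩
    obtain ⟨hlt, hm⟩ := Nat.find_spec hex
    refine ⟨Nat.find hex, hlt, fun p => ⟨fun hp => ?_, fun hp => ?_⟩⟩
    · by_contra hle
      have h1 := hmono ⟨Nat.find hex, hlt⟩ p (by simpa [Fin.le_def] using not_lt.1 hle)
      have h2 := hblt Q hQ _ _ hp hm
      simp only [hkey] at h1
      split_ifs at h1 <;> lia
    · by_contra hp'
      exact Nat.find_min hex hp ⟨p.2, hp'⟩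
  choose! M hM using hinit
  refine ⟨σ, M, hM, fun p q hq hp hqJ => ?_⟩
  have h1 := hmono p q (by rw [Fin.le_def]; lia)
  simp only [hkey, hp, hqJ, if_true, if_false] at h1
  obtain ⟨Q, hQ, hpQ, hqQ⟩ := hbex _ _ (show b (σ p) < b (σ q) by lia)
  refine ⟨Q, hQ, ?_⟩
  rw [(hM Q hQ).2] at hpQ hqQ
  lia

section

variable {n : ℕ} [NeZero n]

theorem prefixSum_eq_dotProduct (σ : Equiv.Perm (Fin n)) (y : Fin n → ℝ) {m : ℕ} (hm : m ≤ n)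
    {A : Set (Fin n)} (hA : ∀ p : Fin n, σ p ∈ A ↔ (p : ℕ) < m) :
    prefixSum σ y m = indicatorVec A ⬝ᵥ y := by
  classical
  rw [prefixSum_eq_sum_ite σ y hm, dotProduct,
    ← Equiv.sum_comp σ fun i => indicatorVec A i * y i]
  refine Finset.sum_congr rfl fun p _ => ?_
  simp [indicatorVec_apply, hA]

/-- On the hypersimplex, every prefix sum of `x - e_J` is bounded below by a prefix sum at an
initial segment belonging to the chain. -/
theorem exists_prefixSum_le {k : ℕ} {ι : Type*} {S : Set ι} {σ : Equiv.Perm (Fin n)} {M : ι → ℕ}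
    {J : Set (Fin n)} (h0 : ∃ Q ∈ S, M Q = 0)
    (hturn : ∀ p q : Fin n, (q : ℕ) = p + 1 → σ p ∈ J → σ q ∉ J → ∃ Q ∈ S, M Q = q)
    {x : Fin n → ℝ} (hx : x ∈ hypersimplex k n) (hsum : ∑ i, (x - indicatorVec J) i = 0)
    {j : ℕ} (hj : j < n) :
    ∃ Q ∈ S, prefixSum σ (x - indicatorVec J) (M Q) ≤ prefixSum σ (x - indicatorVec J) j := by
  classical
  set y := x - indicatorVec J with hy
  have hstep : ∀ (m : ℕ) (hm : m < n),
      prefixSum σ y (m + 1) = prefixSum σ y m + y (σ ⟨m, hm⟩) := fun m hm => by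
    rw [prefixSum_succ, show Fin.ofNat n m = ⟨m, hm⟩ from Fin.ext (Nat.mod_eq_of_lt hm)]
  have hout : ∀ i, i ∉ J → 0 ≤ y i := fun i hi => by
    simp [hy, indicatorVec_apply, hi, (hx.1 i).1]
  have hin : ∀ i, i ∈ J → y i ≤ 0 := fun i hi => by
    simp [hy, indicatorVec_apply, hi, (hx.1 i).2]
  obtain ⟨Q₀, hQ₀, hM0⟩ := h0
  -- Walking left over elements outside `J` does not raise the prefix sum; the walk stops at
  -- position 0 or just after an element of `J`, both of which are positions of the chain.
  have hleft : ∀ (m : ℕ) (hm : m < n), σ ⟨m, hm⟩ ∉ J →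
      ∃ Q ∈ S, prefixSum σ y (M Q) ≤ prefixSum σ y m := by
    intro m
    induction m with
    | zero => exact fun _ _ => ⟨Q₀, hQ₀, by rw [hM0]⟩
    | succ m ih =>
      intro hm hmJ
      by_cases hprev : σ ⟨m, by lia⟩ ∈ J
      · obtain ⟨Q, hQ, hMQ⟩ := hturn ⟨m, by lia⟩ ⟨m + 1, hm⟩ rfl hprev hmJ
        exact ⟨Q, hQ, by rw [hMQ]⟩
      · obtain ⟨Q, hQ, h⟩ := ih (by lia) hprev
        refine ⟨Q, hQ, h.trans ?_⟩
        rw [hstep m (by lia)]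
        linarith [hout _ hprev]
  -- Walking right over elements of `J` does not raise the prefix sum; the walk stops before an
  -- element outside `J`, or at `n`, where the sum is zero as it is at position 0.
  induction hd : n - j generalizing j with
  | zero => lia
  | succ d ih =>
    by_cases hjJ : σ ⟨j, hj⟩ ∈ J
    · have hle : prefixSum σ y (j + 1) ≤ prefixSum σ y j := by
        rw [hstep j hj]; linarith [hin _ hjJ]
      rcases Nat.lt_or_ge (j + 1) n with h | h
      · obtain ⟨Q, hQ, hQj⟩ := ih h (by lia)
        exact ⟨Q, hQ, hQj.trans hle⟩
      · refine ⟨Q₀, hQ₀, ?_⟩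
        rw [show j + 1 = n by lia, prefixSum_self, hsum] at hle
        rw [hM0]
        exact (by simp [prefixSum] : prefixSum σ y 0 = 0).trans_le hle
    · exact hleft j hj hjJ

/-! ### The chambers of a blade -/

/-- The open chamber of the hypersimplex where the `j`-th prefix sum of `x - p` is the unique
smallest one. -/
def openChamber (k : ℕ) (σ : Equiv.Perm (Fin n)) (p : Fin n → ℝ) (j : ℕ) : Set (Fin n → ℝ) :=
  {x ∈ hypersimplex k n | ∀ m < n, m ≠ j → prefixSum σ (x - p) j < prefixSum σ (x - p) m}

theorem prefixSum_lineMap (σ : Equiv.Perm (Fin n)) (p x z : Fin n → ℝ) (s : ℝ) (m : ℕ) :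
    prefixSum σ (AffineMap.lineMap x z s - p) m =
      (1 - s) * prefixSum σ (x - p) m + s * prefixSum σ (z - p) m := by
  have : AffineMap.lineMap x z s - p = (0 + (1 - s) • (x - p)) + s • (z - p) := by
    rw [AffineMap.lineMap_apply_module]
    ext i; simp; ring
  rw [this, prefixSum_add_smul, prefixSum_add_smul]
  simp [prefixSum]

theorem convex_openChamber (k : ℕ) (σ : Equiv.Perm (Fin n)) (p : Fin n → ℝ) (j : ℕ) :
    Convex ℝ (openChamber k σ p j) := by
  rw [convex_iff_segment_subset]
  intro x hx z hz w hw
  rw [segment_eq_image_lineMap] at hw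
  obtain ⟨s, hs, rfl⟩ := hw
  refine ⟨(convex_hypersimplex k n).lineMap_mem hx.1 hz.1 hs, fun m hm hmj => ?_⟩
  rw [prefixSum_lineMap, prefixSum_lineMap]
  have h1 := hx.2 m hm hmj
  have h2 := hz.2 m hm hmj
  rcases hs.1.eq_or_lt with rfl | h0
  · linarith
  · have h3 := mul_lt_mul_of_pos_left h2 h0
    have h4 := mul_le_mul_of_nonneg_left h1.le (sub_nonneg.2 hs.2)
    linarith

theorem hypersimplex_sdiff_translatedBlade {k : ℕ} (σ : Equiv.Perm (Fin n)) {p : Fin n → ℝ}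
    (hp : p ∈ hypersimplex k n) :
    hypersimplex k n \ (translatedBlade σ p ∩ hypersimplex k n) =
      ⋃ j ∈ Set.Iio n, openChamber k σ p j := by
  ext x
  have hiff : x ∈ translatedBlade σ p ↔ x - p ∈ cyclicBlade σ := by
    constructor
    · rintro ⟨y, hy, rfl⟩; simpa using hy
    · exact fun h => ⟨x - p, h, by simp⟩
  simp only [Set.mem_sdiff, Set.mem_inter_iff, Set.mem_iUnion, Set.mem_Iio, openChamber,
    Set.mem_ofPred_eq, hiff, exists_prop]
  constructor
  · rintro ⟨hx, hxB⟩
    have hsum : ∑ i, (x - p) i = 0 := by simp [hx.2, hp.2]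
    rw [mem_cyclicBlade_iff σ hsum] at hxB
    obtain ⟨j, hj, h⟩ := not_not.1 fun h => hxB ⟨h, hx⟩
    exact ⟨j, hj, hx, h⟩
  · rintro ⟨j, hj, hx, h⟩
    have hsum : ∑ i, (x - p) i = 0 := by simp [hx.2, hp.2]
    rw [mem_cyclicBlade_iff σ hsum]
    exact ⟨hx, fun hB => hB.1 ⟨j, hj, h⟩⟩

/-- Each chamber is convex, hence connected. The strict inequalities define pairwise disjoint open
sets, so no connected set passes from one chamber to another. -/
theorem connectedComponentIn_openChamber {k : ℕ} (σ : Equiv.Perm (Fin n)) (p : Fin n → ℝ) {j : ℕ}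
    (hj : j < n) {x : Fin n → ℝ} (hx : x ∈ openChamber k σ p j) :
    connectedComponentIn (⋃ j ∈ Set.Iio n, openChamber k σ p j) x = openChamber k σ p j := by
  have hsub : openChamber k σ p j ⊆ ⋃ j ∈ Set.Iio n, openChamber k σ p j :=
    Set.subset_biUnion_of_mem (u := fun j => openChamber k σ p j) hj
  refine Set.Subset.antisymm ?_
    ((convex_openChamber k σ p j).isPreconnected.subset_connectedComponentIn hx hsub)
  set W : ℕ → Set (Fin n → ℝ) := fun j => ⋂ m ∈ (Finset.range n).erase j,
    {x | prefixSum σ (x - p) j < prefixSum σ (x - p) m} with hW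
  have hWopen : ∀ j, IsOpen (W j) := fun j => isOpen_biInter_finset fun m _ =>
    isOpen_lt ((continuous_prefixSum σ j).comp (continuous_id.sub continuous_const))
      ((continuous_prefixSum σ m).comp (continuous_id.sub continuous_const))
  have hmemW : ∀ j x, x ∈ W j ↔
      ∀ m < n, m ≠ j → prefixSum σ (x - p) j < prefixSum σ (x - p) m := fun j x => by
    simp only [hW, Set.mem_iInter, Finset.mem_erase, Finset.mem_range, Set.mem_ofPred_eq]
    exact ⟨fun h m h1 h2 => h m ⟨h2, h1⟩, fun h m h1 => h m h1.2 h1.1⟩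
  have hcov := connectedComponentIn_subset (⋃ j ∈ Set.Iio n, openChamber k σ p j) x
  have hleft : connectedComponentIn (⋃ j ∈ Set.Iio n, openChamber k σ p j) x ⊆ W j := by
    refine isPreconnected_connectedComponentIn.subset_left_of_subset_union (hWopen j)
      (v := ⋃ l ∈ {l | l < n ∧ l ≠ j}, W l) (isOpen_biUnion fun l _ => hWopen l) ?_ ?_ ?_
    · rw [Set.disjoint_left]
      intro z hz hz'
      obtain ⟨l, hl, hzl⟩ := Set.mem_iUnion₂.1 hz'
      exact lt_asymm ((hmemW j z).1 hz l hl.1 hl.2) ((hmemW l z).1 hzl j hj hl.2.symm)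
    · intro z hz
      obtain ⟨l, hl, hzl⟩ := Set.mem_iUnion₂.1 (hcov hz)
      by_cases h : l = j
      · exact Or.inl ((hmemW j z).2 (h ▸ hzl.2))
      · exact Or.inr (Set.mem_iUnion₂.2 ⟨l, ⟨hl, h⟩, (hmemW l z).2 hzl.2⟩)
    · exact ⟨x, mem_connectedComponentIn (hsub hx), (hmemW j x).2 hx.2⟩
  intro z hz
  obtain ⟨l, -, hzl⟩ := Set.mem_iUnion₂.1 (hcov hz)
  exact ⟨hzl.1, (hmemW j z).1 (hleft hz)⟩

end

/-! ### The theorem -/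

theorem IsChainSubdivision.exists_induces {n k : ℕ} [NeZero n] {S : Set (Set (Fin n → ℝ))}
    {J : Set (Fin n)} {N : Set (Fin n → ℝ) → Set (Fin n)} (hS : IsChainSubdivision k S J N)
    (hfin : S.Finite) (hclosed : ∀ Q ∈ S, IsClosed Q) :
    ∃ σ : Equiv.Perm (Fin n),
      Induces (translatedBlade σ (indicatorVec J) ∩ hypersimplex k n) (hypersimplex k n) S := by
  classical
  obtain ⟨σ, M, hM, hturn⟩ := exists_perm_of_chain hfin N J hS.chain hS.compl_nonempty
  refine ⟨σ, ?_⟩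
  set c := indicatorVec J with hc
  obtain ⟨Q₀, hQ₀, hN0⟩ := hS.exists_empty
  have hcΔ : c ∈ hypersimplex k n := ((hS.mem_iff Q₀ hQ₀ c).1 (hS.isCellAt Q₀ hQ₀).mem).1
  have hM0 : M Q₀ = 0 := by
    have := (hM Q₀ hQ₀).2 0
    rw [hN0] at this
    simpa using this
  have hsum : ∀ x ∈ hypersimplex k n, ∑ i, (x - c) i = 0 := fun x hx => by
    simp [hx.2, hcΔ.2]
  have hG : ∀ Q ∈ S, ∀ x, indicatorVec (N Q) ⬝ᵥ (x - c) = prefixSum σ (x - c) (M Q) :=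
    fun Q hQ x => (prefixSum_eq_dotProduct σ _ (hM Q hQ).1.le (hM Q hQ).2).symm
  have hlow : ∀ x ∈ hypersimplex k n, ∀ j < n,
      ∃ Q ∈ S, prefixSum σ (x - c) (M Q) ≤ prefixSum σ (x - c) j := fun x hx j hj =>
    exists_prefixSum_le ⟨Q₀, hQ₀, hM0⟩ hturn hx (hsum x hx) hj
  have hmin : ∀ Q ∈ S, ∀ x ∈ Q, ∀ m < n,
      prefixSum σ (x - c) (M Q) ≤ prefixSum σ (x - c) m := by
    intro Q hQ x hx m hm
    obtain ⟨hxΔ, hxN⟩ := (hS.mem_iff Q hQ x).1 hx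
    obtain ⟨R, hR, hRm⟩ := hlow x hxΔ m hm
    have := hxN R hR
    rw [hG Q hQ, hG R hR] at this
    exact this.trans hRm
  -- A unique minimum at `j` must be at a position of the chain, so the remaining chambers are
  -- empty.
  have hchamber : ∀ j < n, ∀ x ∈ openChamber k σ c j, ∃ Q ∈ S, M Q = j := by
    intro j hj x hx
    obtain ⟨Q, hQ, h⟩ := hlow x hx.1 j hj
    refine ⟨Q, hQ, ?_⟩
    by_contra hne
    exact absurd (hx.2 (M Q) (hM Q hQ).1 hne) (not_lt.2 h)
  have hstrict : ∀ Q ∈ S, (openChamber k σ c (M Q)).Nonempty := by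
    intro Q hQ
    have hcell := hS.isCellAt Q hQ
    set A : ℕ → Set (Fin n) := fun m => {i | (σ.symm i : ℕ) < m} with hA
    have hAm : ∀ m < n, ∀ x, prefixSum σ (x - c) m = indicatorVec (A m) ⬝ᵥ (x - c) :=
      fun m hm x => prefixSum_eq_dotProduct σ _ hm.le fun p => by simp [hA]
    obtain ⟨z, hz, hzlt⟩ := hcell.convex.exists_forall_dotProduct_lt ⟨_, hcell.mem⟩
      ((Finset.range n).erase (M Q))
      (fun m => indicatorVec (A m) - indicatorVec (A (M Q)))
      (fun m => (indicatorVec (A m) - indicatorVec (A (M Q))) ⬝ᵥ c)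
      (fun m hm x hx => by
        have := hmin Q hQ x hx m (by simp at hm; exact hm.2)
        rw [hAm _ (hM Q hQ).1, hAm m (by simp at hm; exact hm.2), dotProduct_sub,
          dotProduct_sub] at this
        rw [sub_dotProduct, sub_dotProduct]
        linarith)
      (fun m hm => by
        obtain ⟨hmM, hmn⟩ : m ≠ M Q ∧ m < n := by simpa using hm
        by_contra! hcon
        have hconst : ∀ x ∈ Q, (indicatorVec (A m) - indicatorVec (A (M Q))) ⬝ᵥ x =
            (indicatorVec (A m) - indicatorVec (A (M Q))) ⬝ᵥ c := fun x hx =>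
          le_antisymm (hcon x hx) (by
            have := hmin Q hQ x hx m hmn
            rw [hAm _ (hM Q hQ).1, hAm m hmn, dotProduct_sub, dotProduct_sub] at this
            rw [sub_dotProduct, sub_dotProduct]
            linarith)
        have hMn := (hM Q hQ).1
        -- The difference of the two initial segments is `±1` at position `min m (M Q)` and 0 at the
        -- last position, which neither segment reaches; so it is not constant on the
        -- full-dimensional cell.
        have h1 := eq_of_const_on_fullDim (NeZero.pos n) hcell.dim hcell.sum hconst
          (σ ⟨min m (M Q), by lia⟩) (σ ⟨n - 1, by lia⟩)
        have e1 : ¬ n - 1 < m := by lia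
        have e2 : ¬ n - 1 < M Q := by lia
        rcases lt_or_gt_of_ne hmM with h | h
        · simp [indicatorVec_apply, hA, e1, e2, min_eq_left h.le, h] at h1
        · simp [indicatorVec_apply, hA, e1, e2, min_eq_right h.le, h] at h1)
    refine ⟨z, ((hS.mem_iff Q hQ z).1 hz).1, fun m hm hmM => ?_⟩
    have := hzlt m (by simp [hm, hmM])
    rw [sub_dotProduct, sub_dotProduct] at this
    rw [hAm _ (hM Q hQ).1, hAm m hm, dotProduct_sub, dotProduct_sub]
    linarith
  have hclosure : ∀ Q ∈ S, closure (openChamber k σ c (M Q)) = Q := by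
    intro Q hQ
    refine Set.Subset.antisymm (closure_minimal (fun x hx => ?_) (hclosed Q hQ)) fun x hx => ?_
    · refine (hS.mem_iff Q hQ x).2 ⟨hx.1, fun R hR => ?_⟩
      rw [hG Q hQ, hG R hR]
      by_cases h : M R = M Q
      · rw [h]
      · exact (hx.2 _ (hM R hR).1 h).le
    -- On the segment from `x` to a point `z` of the chamber, weak minimality at `x` and strict
    -- minimality at `z` give strict minimality everywhere except possibly at `x`.
    · obtain ⟨z, hz⟩ := hstrict Q hQ
      refine mem_closure_of_forall_lineMap_mem (z := z) fun s hs hs1 => ?_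
      refine ⟨(convex_hypersimplex k n).lineMap_mem ((hS.mem_iff Q hQ x).1 hx).1 hz.1
        ⟨hs.le, hs1⟩, fun m hm hmM => ?_⟩
      rw [prefixSum_lineMap, prefixSum_lineMap]
      have h1 := mul_le_mul_of_nonneg_left (hmin Q hQ x hx m hm) (sub_nonneg.2 hs1)
      have h2 := mul_lt_mul_of_pos_left (hz.2 m hm hmM) hs
      linarith
  rw [Induces, hypersimplex_sdiff_translatedBlade σ hcΔ]
  ext Q
  constructor
  · intro hQ
    obtain ⟨z, hz⟩ := hstrict Q hQ
    refine ⟨z, Set.mem_iUnion₂.2 ⟨M Q, (hM Q hQ).1, hz⟩, ?_⟩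
    rw [connectedComponentIn_openChamber σ c (hM Q hQ).1 hz, hclosure Q hQ]
  · rintro ⟨x, hx, rfl⟩
    obtain ⟨j, hj, hxj⟩ := Set.mem_iUnion₂.1 hx
    obtain ⟨R, hR, rfl⟩ := hchamber j hj x hxj
    rw [connectedComponentIn_openChamber σ c hj hxj, hclosure R hR]
    exact hR

theorem mainTheorem5 (n k : ℕ) (hk : 1 ≤ k) (hkn : k + 1 ≤ n)
    (S : Set (Set (Fin n → ℝ)))
    (hsplit : IsMultiSplit (hypersimplex k n) S)
    (hmatroid : IsMatroidSubdivision (hypersimplex k n) S) :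
    ∃ (J : Finset (Fin n)) (σ : Equiv.Perm (Fin n)), J.card = k ∧
      Induces (translatedBlade σ (indicatorVec (J : Set (Fin n))) ∩ hypersimplex k n)
        (hypersimplex k n) S := by
  classical
  obtain ⟨d, hd⟩ := hsplit
  have : NeZero n := ⟨by lia⟩
  have hne : S.Nonempty := by
    rw [Set.nonempty_iff_ne_empty]
    rintro rfl
    have := hd.card
    have := hd.one_le
    simp at *
    lia
  obtain ⟨J, N, hJN⟩ := hmatroid.exists_isChainSubdivision hk hkn hne hd.common hd.facet
  obtain ⟨σ, hσ⟩ := hJN.exists_induces hmatroid.1.finite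
    fun Q hQ => (hmatroid.1.polytope Q hQ).isCompact.isClosed
  refine ⟨J.toFinset, σ, ?_, by rwa [Set.coe_toFinset]⟩
  obtain ⟨Q, hQ⟩ := hne
  have h := (hJN.isCellAt Q hQ).sum _ (hJN.isCellAt Q hQ).mem
  have h2 := one_dotProduct_indicatorVec J.toFinset
  rw [Set.coe_toFinset, h] at h2
  exact_mod_cast h2.symm
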